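/- Let $d\ge 1$, let $\mathcal H_r=\ell^2(\mathbb Z)$ with canonical basis $(\Psi_j)_{j\in\mathbb Z}$ and $\mathcal H_s=\mathbb C^d$ with canonical basis $e_0,\dots,e_{d-1}$. Let $b_j^{\#}$ and $a_j^{\#}$ be the fermionic creation/annihilation operators associated with $\Psi_j$ and $e_j$ on the antisymmetric Fock spaces $\mathcal F_-(\mathcal H_r)$ and $\mathcal F_-(\mathcal H_s)$. Let $S\Psi_j=\Psi_{j-1}$ be the shift and $S_pe_j=e_{j-1}$ (indices modulo $d$) the periodic shift. For $\alpha\in\mathbb R$ consider on $\mathcal F_-(\mathcal H_r)\otimes\mathcal F_-(\mathcal H_s)$ the unitary operator $$U=(\Gamma(S)\otimes\Gamma(S_p))\,\exp\big[-i\alpha(b_0^*\otimes a_0+b_0\otimes a_0^*)\big]$$ and the evolution $\tau^t(X)=U^{*t}XU^t$. Let $0\le\sigma\le1$ and let $\omega$ be the gauge-invariant quasi-free state of the reservoir with density $\Sigma=\sigma\,\mathbb 1$, i.e. $\omega(b^*(\phi_m)\cdots b^*(\phi_1)b(\psi_1)\cdots b(\psi_n))=\delta_{mn}\det\big(\langle\psi_j,\Sigma\phi_k\rangle\big)_{j,k}$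 for all $m,n$. Let $\rho$ be any density matrix (positive, trace one) on $\mathcal F_-(\mathcal H_s)$. The state of the sample at time $t$ is $\rho_t(A)=(\omega\otimes\rho)(\tau^t(\mathbb 1\otimes A))$. The $p$-body reduced density matrix of a state $\nu$ of the sample is the operator $\nu^{(p)}$ on $\mathcal H_s^{\wedge p}$ with $$\langle e_{j_1}\wedge\dots\wedge e_{j_p}\,|\,\nu^{(p)}\,e_{k_1}\wedge\dots\wedge e_{k_p}\rangle=\nu(a_{k_1}^*\cdots a_{k_p}^*a_{j_p}\cdots a_{j_1}),\qquad u_1\wedge\dots\wedge u_p=\tfrac1{\sqrt{p!}}\sum_{\pi\in S_p}\epsilon_\pi\,u_{\pi(1)}\otimes\dots\otimes u_{\pi(p)}.$$ It is extended by zero to $\mathcal H_s^{\otimes p}$. Write $\rho^{(p)}$ for that of the initial state $A\mapsto\operatorname{tr}(\rho A)$ and $\rho^{(p)}_m$ for that of the state $\rho_{md}$ at time $md$. Let $P_A^{(p)}$ be the orthogonal projection of $\mathcal H_s^{\otimes p}$ onto $\mathcal H_s^{\wedge p}$. Then for all integers $m\ge0$ and $0\le p\le d$, $$\rho^{(p)}_m=\sum_{k=0}^{p}\binom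 pk\,(1-\cos^{2m}\alpha)^{p-k}\cos^{2mk}\alpha\;\,P_A^{(p)}\big(\rho^{(k)}\otimes\underbrace{\sigma\mathbb 1_{\mathcal H_s}\otimes\dots\otimes\sigma\mathbb 1_{\mathcal H_s}}_{p-k}\big)P_A^{(p)}.$$ -/

import Mathlib

open scoped TensorProduct InnerProductSpace ComplexOrder

noncomputable section

namespace FermiWalk

/-! ## The antisymmetric Fock space over `ℓ²(ι)` -/

/-- Indices of the canonical basis `e_{x 0} ⊗ ⋯ ⊗ e_{x (p-1)}` of `⨁ₚ ℓ²(ι)^{⊗ p}`. -/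
abbrev FockIndex (ι : Type) : Type := Σ p : ℕ, (Fin p → ι)

/-- The full Fock space `⨁ₚ ℓ²(ι)^{⊗ p}` (Hilbert sum), where `ℓ²(ι)^{⊗ p}` is realised as
`ℓ²(ι ^ p)`: the value at `⟨p, x⟩` is the coefficient of `e_{x 0} ⊗ ⋯ ⊗ e_{x (p-1)}`. -/
abbrev FullFock (ι : Type) : Type := lp (fun _ : FockIndex ι => ℂ) 2

/-- The signature of a permutation as a complex number. -/
def sgn {p : ℕ} (π : Equiv.Perm (Fin p)) : ℂ := ((Equiv.Perm.sign π : ℤ) : ℂ)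

lemma norm_sgn {p : ℕ} (π : Equiv.Perm (Fin p)) : ‖sgn π‖ = 1 := by
  rcases Int.units_eq_one_or (Equiv.Perm.sign π) with h | h <;> simp [sgn, h]

/-- The vectors of the full Fock space all of whose components are antisymmetric. -/
def antisymmetric (ι : Type) : Submodule ℂ (FullFock ι) where
  carrier := {f | ∀ (p : ℕ) (π : Equiv.Perm (Fin p)) (x : Fin p → ι),
    f ⟨p, x ∘ π⟩ = sgn π * f ⟨p, x⟩}
  add_mem' := by
    intro f g hf hg p π x
    rw [lp.coeFn_add, Pi.add_apply, Pi.add_apply, hf p π x, hg p π x, mul_add]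
  zero_mem' := by intro p π x; simp
  smul_mem' := by
    intro c f hf p π x
    rw [lp.coeFn_smul, Pi.smul_apply, Pi.smul_apply, hf p π x, smul_eq_mul, smul_eq_mul]
    ring

/-- The antisymmetric Fock space `F₋(ℓ²(ι))`. -/
def Fock (ι : Type) : Type := ↥(antisymmetric ι)

instance (ι : Type) : NormedAddCommGroup (Fock ι) :=
  inferInstanceAs (NormedAddCommGroup ↥(antisymmetric ι))

instance (ι : Type) : InnerProductSpace ℂ (Fock ι) :=
  inferInstanceAs (InnerProductSpace ℂ ↥(antisymmetric ι))

/-- The coefficients of a vector of Fock space in the basis `e_{x 0} ⊗ ⋯ ⊗ e_{x (p-1)}`. -/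
def coeff {ι : Type} (f : Fock ι) (q : FockIndex ι) : ℂ := f.1 q

lemma coeff_ext {ι : Type} {f g : Fock ι} (h : ∀ q, coeff f q = coeff g q) : f = g :=
  Subtype.ext (lp.ext (funext h))

lemma coeff_add {ι : Type} (f g : Fock ι) (q : FockIndex ι) :
    coeff (f + g) q = coeff f q + coeff g q := rfl

lemma coeff_smul {ι : Type} (c : ℂ) (f : Fock ι) (q : FockIndex ι) :
    coeff (c • f) q = c * coeff f q := rfl

lemma coeff_perm {ι : Type} (f : Fock ι) {p : ℕ} (π : Equiv.Perm (Fin p)) (x : Fin p → ι) :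
    coeff f ⟨p, x ∘ π⟩ = sgn π * coeff f ⟨p, x⟩ := f.2 p π x

lemma coeff_eq_zero {ι : Type} (f : Fock ι) {p : ℕ} (x : Fin p → ι)
    (hx : ¬ Function.Injective x) : coeff f ⟨p, x⟩ = 0 := by
  simp only [Function.Injective, not_forall] at hx
  obtain ⟨a, b, hab, hne⟩ := hx
  have h := coeff_perm f (Equiv.swap a b) x
  have hxs : x ∘ (Equiv.swap a b) = x := by
    funext i
    simp only [Function.comp_apply, Equiv.swap_apply_def]
    split_ifs with h1 h2
    · rw [h1, hab]
    · rw [h2, hab]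
    · rfl
  rw [hxs] at h
  simp only [sgn, Equiv.Perm.sign_swap hne] at h
  push_cast at h
  linear_combination h / 2

lemma sum_coeff_le {ι : Type} (f : Fock ι) (s : Finset (FockIndex ι)) :
    ∑ q ∈ s, ‖coeff f q‖ ^ 2 ≤ ‖f‖ ^ 2 := by
  have h := lp.sum_rpow_le_norm_rpow (p := 2) (by norm_num) f.1 s
  simp only [ENNReal.toReal_ofNat, Real.rpow_ofNat] at h
  exact h

instance (ι : Type) : CompleteSpace (Fock ι) := by
  have h : ((antisymmetric ι : Submodule ℂ (FullFock ι)) : Set (FullFock ι)) =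
      ⋂ (p : ℕ) (π : Equiv.Perm (Fin p)) (x : Fin p → ι),
        {f | f ⟨p, x ∘ π⟩ = sgn π * f ⟨p, x⟩} := by
    ext f
    simp only [Set.mem_iInter]
    rfl
  have hcl : IsClosed ((antisymmetric ι : Submodule ℂ (FullFock ι)) : Set (FullFock ι)) := by
    rw [h]
    refine isClosed_iInter fun p => isClosed_iInter fun π => isClosed_iInter fun x => ?_
    have hc : ∀ q : FockIndex ι, Continuous fun f : FullFock ι => f q :=
      fun q => (lp.evalCLM ℂ (fun _ : FockIndex ι => ℂ) 2 q).continuous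
    exact isClosed_eq (hc _) (continuous_const.mul (hc _))
  exact hcl.isComplete.completeSpace_coe

/-- The linear contraction of Fock space which is given on coefficients by `T`. -/
def contraction {ι : Type} (T : Fock ι → FockIndex ι → ℂ)
    (hadd : ∀ f g q, T (f + g) q = T f q + T g q) (hsmul : ∀ (c : ℂ) f q, T (c • f) q = c * T f q)
    (hanti : ∀ f (p : ℕ) (π : Equiv.Perm (Fin p)) (x : Fin p → ι),
      T f ⟨p, x ∘ π⟩ = sgn π * T f ⟨p, x⟩)
    (hbound : ∀ f (s : Finset (FockIndex ι)), ∑ q ∈ s, ‖T f q‖ ^ 2 ≤ ‖f‖ ^ 2) :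
    Fock ι →L[ℂ] Fock ι :=
  LinearMap.mkContinuous
    { toFun := fun f => ⟨⟨T f, memℓp_gen' (C := ‖f‖ ^ 2) (by simpa using hbound f)⟩,
        fun p π x => hanti f p π x⟩
      map_add' := fun f g => coeff_ext (hadd f g)
      map_smul' := fun c f => coeff_ext (hsmul c f) }
    1 (fun f => by
      rw [one_mul]
      refine lp.norm_le_of_forall_sum_le (p := 2) (by norm_num) (norm_nonneg _) fun s => ?_
      simp only [ENNReal.toReal_ofNat, Real.rpow_ofNat]
      exact hbound f s)

lemma coeff_contraction {ι : Type} (T : Fock ι → FockIndex ι → ℂ) (hadd hsmul hanti hbound)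
    (f : Fock ι) (q : FockIndex ι) :
    coeff (contraction T hadd hsmul hanti hbound f) q = T f q := rfl

/-! ## Creation and annihilation operators -/

lemma sum_annihilate_le {ι : Type} (j : ι) (f : Fock ι) (s : Finset (FockIndex ι)) :
    ∑ q ∈ s, ‖((Real.sqrt (q.1 + 1) : ℝ) : ℂ) * coeff f ⟨q.1 + 1, Fin.cons j q.2⟩‖ ^ 2
      ≤ ‖f‖ ^ 2 := by
  classical
  let Φ : (Σ q : FockIndex ι, Fin (q.1 + 1)) → FockIndex ι :=
    fun t => ⟨t.1.1 + 1, t.2.insertNth j t.1.2⟩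
  have h1 : ∀ q : FockIndex ι,
      ‖((Real.sqrt (q.1 + 1) : ℝ) : ℂ) * coeff f ⟨q.1 + 1, Fin.cons j q.2⟩‖ ^ 2 =
      ∑ i : Fin (q.1 + 1), ‖coeff f (Φ ⟨q, i⟩)‖ ^ 2 := by
    intro q
    have h2 : ∀ i : Fin (q.1 + 1), ‖coeff f (Φ ⟨q, i⟩)‖ =
        ‖coeff f ⟨q.1 + 1, Fin.cons j q.2⟩‖ := by
      intro i
      have h4 : (Fin.cons j q.2 : Fin (q.1 + 1) → ι) ∘ i.cycleRange = i.insertNth j q.2 :=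
        Fin.cons_comp_cycleRange j q.2 i
      rw [show Φ ⟨q, i⟩ = ⟨q.1 + 1, (Fin.cons j q.2 : Fin (q.1 + 1) → ι) ∘ i.cycleRange⟩ by
        rw [h4], coeff_perm, norm_mul, norm_sgn, one_mul]
    simp only [h2]
    rw [Finset.sum_const, Finset.card_univ, Fintype.card_fin, norm_mul, mul_pow,
      Complex.norm_real, Real.norm_of_nonneg (Real.sqrt_nonneg _), Real.sq_sqrt (by positivity)]
    simp
  rw [Finset.sum_congr rfl fun q _ => h1 q,
    Finset.sum_sigma' s (fun q => Finset.univ) (fun q i => ‖coeff f (Φ ⟨q, i⟩)‖ ^ 2),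
    ← Finset.sum_filter_of_ne (p := fun t => coeff f (Φ t) ≠ 0)
      (fun t _ ht h0 => ht (by simp [h0]))]
  refine le_trans (le_of_eq ?_) (sum_coeff_le f (Finset.image Φ
    (Finset.filter (fun t => coeff f (Φ t) ≠ 0) (s.sigma fun q => Finset.univ))))
  rw [Finset.sum_image]
  rintro ⟨⟨p, x⟩, i⟩ ht ⟨⟨p', x'⟩, i'⟩ ht' h
  have hinj : Function.Injective (i.insertNth j x : Fin (p + 1) → ι) := by
    by_contra hc
    exact (Finset.mem_filter.1 ht).2 (coeff_eq_zero f _ hc)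
  simp only [Φ, Sigma.mk.injEq, Nat.add_right_cancel_iff] at h
  obtain ⟨rfl, h⟩ := h
  have h := eq_of_heq h
  have hi : i = i' := by
    apply hinj
    rw [Fin.insertNth_apply_same, h, Fin.insertNth_apply_same]
  subst hi
  have hx : x = x' := by
    funext k
    have := congrFun h (i.succAbove k)
    simpa using this
  subst hx
  rfl

/-- The annihilation operator `c_j = c(e_j)` on `F₋(ℓ²(ι))`:
`(c_j f)(x₁, …, x_p) = √(p + 1) f(j, x₁, …, x_p)`. With the normalisation
`u₁ ∧ ⋯ ∧ u_q = (q!)^{-1/2} ∑_π sgn(π) u_{π 1} ⊗ ⋯ ⊗ u_{π q}` this says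
`c_j (u₁ ∧ ⋯ ∧ u_q) = ∑_r (-1)^{r-1} ⟨e_j, u_r⟩ u₁ ∧ ⋯ û_r ⋯ ∧ u_q`. -/
def annihilate {ι : Type} (j : ι) : Fock ι →L[ℂ] Fock ι :=
  contraction
    (fun f q => ((Real.sqrt (q.1 + 1) : ℝ) : ℂ) * coeff f ⟨q.1 + 1, Fin.cons j q.2⟩)
    (fun f g q => by rw [coeff_add, mul_add])
    (fun c f q => by rw [coeff_smul]; ring)
    (fun f p π x => by
      have h : (Fin.cons j (x ∘ π) : Fin (p + 1) → ι) =
          (Fin.cons j x : Fin (p + 1) → ι) ∘ Equiv.Perm.decomposeFin.symm (0, π) := by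
        funext i
        refine Fin.cases ?_ (fun k => ?_) i <;> simp
      have hs : sgn (Equiv.Perm.decomposeFin.symm (0, π)) = sgn π := by
        simp [sgn, Equiv.Perm.decomposeFin.symm_sign]
      simp only
      rw [h, coeff_perm, hs]
      ring)
    (sum_annihilate_le j)

/-- The creation operator `c_j^* = c^*(e_j)`. -/
def create {ι : Type} (j : ι) : Fock ι →L[ℂ] Fock ι :=
  ContinuousLinearMap.adjoint (annihilate j)

/-! ## Second quantization of a permutation of the canonical basis -/

/-- `Γ(V)` for the unitary `V` of `ℓ²(ι)` with `V e_j = e_{τ j}`, i.e. the restriction of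
`⨁ₚ V^{⊗ p}` to antisymmetric vectors: `(Γ(V) f)(x₁, …, x_p) = f(τ⁻¹ x₁, …, τ⁻¹ x_p)`. -/
def secondQuant {ι : Type} (τ : Equiv.Perm ι) : Fock ι →L[ℂ] Fock ι :=
  contraction
    (fun f q => coeff f ⟨q.1, τ.symm ∘ q.2⟩)
    (fun f g q => coeff_add f g _)
    (fun c f q => coeff_smul c f _)
    (fun f p π x => coeff_perm f π (τ.symm ∘ x))
    (fun f s => by
      classical
      have hinj : Function.Injective fun q : FockIndex ι =>
          (⟨q.1, τ.symm ∘ q.2⟩ : FockIndex ι) := by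
        rintro ⟨p, x⟩ ⟨p', x'⟩ h
        simp only [Sigma.mk.injEq] at h
        obtain ⟨rfl, h⟩ := h
        have h := eq_of_heq h
        have : x = x' := funext fun i => τ.symm.injective (congrFun h i)
        rw [this]
      rw [← Finset.sum_image (s := s) (f := fun q => ‖coeff f q‖ ^ 2)
        (fun a _ b _ h => hinj h)]
      exact sum_coeff_le f _)

/-- The translation `j ↦ j - 1`. On `ℤ` it gives the shift of `ℓ²(ℤ)`, on `Fin d`, where it is
understood modulo `d`, the periodic shift of `ℂ^d`. -/
def shiftPerm (ι : Type) [AddGroup ι] [One ι] : Equiv.Perm ι := Equiv.subRight 1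

/-! ## The coupled system -/

instance (d : ℕ) : FiniteDimensional ℂ (Fock (Fin d)) := by
  let L : Fock (Fin d) →ₗ[ℂ] ((Σ p : Fin (d + 1), (Fin p → Fin d)) → ℂ) :=
    { toFun := fun f q => coeff f ⟨q.1, q.2⟩
      map_add' := fun f g => rfl
      map_smul' := fun c f => rfl }
  refine FiniteDimensional.of_injective L fun f g h => coeff_ext ?_
  rintro ⟨p, x⟩
  by_cases hp : p < d + 1
  · exact congrFun h ⟨⟨p, hp⟩, x⟩
  · have hx : ¬ Function.Injective x := by
      intro hx
      have := Fintype.card_le_of_injective x hx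
      simp at this
      omega
    rw [coeff_eq_zero f x hx, coeff_eq_zero g x hx]

/-- The Hilbert space `F₋(ℓ²(ℤ)) ⊗ F₋(ℂ^d)` of reservoir and sample. Since the second factor is
finite-dimensional, the algebraic tensor product is complete. -/
def System (d : ℕ) : Type := Fock ℤ ⊗[ℂ] Fock (Fin d)

instance (d : ℕ) : NormedAddCommGroup (System d) :=
  inferInstanceAs (NormedAddCommGroup (Fock ℤ ⊗[ℂ] Fock (Fin d)))

instance (d : ℕ) : InnerProductSpace ℂ (System d) :=
  inferInstanceAs (InnerProductSpace ℂ (Fock ℤ ⊗[ℂ] Fock (Fin d)))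

/-- The embedding `ψ ↦ ψ ⊗ v` of the reservoir space. -/
def tensorRight {d : ℕ} (v : Fock (Fin d)) : Fock ℤ →L[ℂ] System d :=
  (TensorProduct.mkL ℂ (Fock ℤ) (Fock (Fin d))).flip v

/-- The operator `B ⊗ 1`. -/
def onReservoir {d : ℕ} (B : Fock ℤ →L[ℂ] Fock ℤ) : System d →L[ℂ] System d :=
  B.rTensor (Fock (Fin d))

/-- The operator `1 ⊗ A`. -/
def onSample {d : ℕ} (A : Fock (Fin d) →L[ℂ] Fock (Fin d)) : System d →L[ℂ] System d :=
  A.lTensor (Fock ℤ)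

lemma onReservoir_tensorRight {d : ℕ} (B : Fock ℤ →L[ℂ] Fock ℤ) (v : Fock (Fin d)) (ψ : Fock ℤ) :
    onReservoir B (tensorRight v ψ) = tensorRight v (B ψ) := rfl

lemma onSample_tensorRight {d : ℕ} (A : Fock (Fin d) →L[ℂ] Fock (Fin d)) (v : Fock (Fin d))
    (ψ : Fock ℤ) : onSample A (tensorRight v ψ) = tensorRight (A v) ψ := rfl

lemma inner_tensorRight {d : ℕ} (v w : Fock (Fin d)) (φ ψ : Fock ℤ) :
    ⟪tensorRight v φ, tensorRight w ψ⟫_ℂ = ⟪φ, ψ⟫_ℂ * ⟪v, w⟫_ℂ := rfl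

lemma complete_tensor (d : ℕ) : CompleteSpace (Fock ℤ ⊗[ℂ] Fock (Fin d)) := by
  let e := stdOrthonormalBasis ℂ (Fock (Fin d))
  let R : Fock (Fin d) → Fock ℤ →L[ℂ] Fock ℤ ⊗[ℂ] Fock (Fin d) := fun v =>
    (TensorProduct.mkL ℂ (Fock ℤ) (Fock (Fin d))).flip v
  let Φ : ∀ _ : Fin (Module.finrank ℂ (Fock (Fin d))),
      Fock ℤ ⊗[ℂ] Fock (Fin d) →L[ℂ] Fock ℤ := fun i =>
    (TensorProduct.ridIsometry ℂ (Fock ℤ)).toContinuousLinearEquiv.toContinuousLinearMap ∘L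
      (innerSL ℂ (e i)).lTensor (Fock ℤ)
  have hΦ : ∀ x, ∑ i, R (e i) (Φ i x) = x := by
    intro x
    induction x using TensorProduct.induction_on with
    | zero => simp
    | tmul a b =>
      have h1 : ∀ i, R (e i) (Φ i (a ⊗ₜ b)) = a ⊗ₜ[ℂ] (⟪e i, b⟫_ℂ • e i) := by
        intro i
        have h2 : Φ i (a ⊗ₜ b) = ⟪e i, b⟫_ℂ • a := by
          simp [Φ]
        rw [h2, map_smul, TensorProduct.tmul_smul]
        rfl
      rw [Finset.sum_congr rfl fun i _ => h1 i, ← TensorProduct.tmul_sum, e.sum_repr']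
    | add a b ha hb =>
      simp only [map_add, Finset.sum_add_distrib, ha, hb]
  refine Metric.complete_of_cauchySeq_tendsto fun u hu => ?_
  have hy : ∀ i, ∃ y, Filter.Tendsto (fun n => Φ i (u n)) Filter.atTop (nhds y) := fun i =>
    cauchySeq_tendsto_of_complete ((Φ i).uniformContinuous.comp_cauchySeq hu)
  choose y hy using hy
  refine ⟨∑ i, R (e i) (y i), ?_⟩
  have h3 : Filter.Tendsto (fun n => ∑ i, R (e i) (Φ i (u n))) Filter.atTop
      (nhds (∑ i, R (e i) (y i))) :=
    tendsto_finsetSum _ fun i _ => ((R (e i)).continuous.tendsto _).comp (hy i)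
  simpa only [hΦ] using h3

instance (d : ℕ) : CompleteSpace (System d) := complete_tensor d

/-- The coupling `K = exp(-iα (b₀^* ⊗ a₀ + b₀ ⊗ a₀^*))`. -/
def coupling (d : ℕ) [NeZero d] (α : ℝ) : System d →L[ℂ] System d :=
  NormedSpace.exp ((-(Complex.I * (α : ℂ))) •
    (onReservoir (create 0) * onSample (annihilate 0) +
      onReservoir (annihilate 0) * onSample (create 0)))

/-- The free one-step dynamics `U_F = Γ(S) ⊗ Γ(S_p)`, the shift in the reservoir and the periodic
shift in the sample. -/
def freeStep (d : ℕ) [NeZero d] : System d →L[ℂ] System d :=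
  onReservoir (secondQuant (shiftPerm ℤ)) * onSample (secondQuant (shiftPerm (Fin d)))

/-- The coupled one-step dynamics `U = U_F K`. -/
def step (d : ℕ) [NeZero d] (α : ℝ) : System d →L[ℂ] System d :=
  freeStep d * coupling d α

/-- The Heisenberg evolution `τ^t(X) = (U^*)^t X U^t`. -/
def evolve (d : ℕ) [NeZero d] (α : ℝ) (t : ℕ) (X : System d →L[ℂ] System d) :
    System d →L[ℂ] System d :=
  (ContinuousLinearMap.adjoint (step d α)) ^ t * X * (step d α) ^ t

/-! ## States -/

/-- The one-particle space `ℓ²(ℤ)` of the reservoir. -/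
abbrev ReservoirSpace : Type := lp (fun _ : ℤ => ℂ) 2

/-- The canonical basis vector `Ψ_j` of `ℓ²(ℤ)`. -/
def Psi (j : ℤ) : ReservoirSpace := lp.single 2 j 1

/-- A state: a positive normalised linear functional, here on all bounded operators of the
reservoir Fock space. (Every state of the CAR algebra is the restriction of such a functional.) -/
def IsState (ω : (Fock ℤ →L[ℂ] Fock ℤ) →ₗ[ℂ] ℂ) : Prop :=
  (∀ T, 0 ≤ ω (star T * T)) ∧ ω 1 = 1

/-- On the CAR algebra of the reservoir `ω` is the gauge-invariant quasi-free state with density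
`S`: `ω(b^*(φ_m) ⋯ b^*(φ_1) b(ψ_1) ⋯ b(ψ_n)) = δ_{mn} det (⟨ψ_j, S φ_k⟩)`. By (anti)linearity and
continuity it is enough to let the `φ`'s and `ψ`'s run through the canonical basis; `φ i`, `ψ i`
are the labels of the basis vectors. -/
def IsQuasiFree (S : ReservoirSpace →L[ℂ] ReservoirSpace)
    (ω : (Fock ℤ →L[ℂ] Fock ℤ) →ₗ[ℂ] ℂ) : Prop :=
  (∀ (m n : ℕ) (φ : Fin m → ℤ) (ψ : Fin n → ℤ), m ≠ n →
    ω ((List.ofFn fun i => create (φ i)).reverse.prod *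
      (List.ofFn fun i => annihilate (ψ i)).prod) = 0) ∧
  ∀ (n : ℕ) (φ ψ : Fin n → ℤ),
    ω ((List.ofFn fun i => create (φ i)).reverse.prod *
      (List.ofFn fun i => annihilate (ψ i)).prod) =
      (Matrix.of fun j k => ⟪Psi (ψ j), S (Psi (φ k))⟫_ℂ).det

/-- A density matrix on the sample Fock space. -/
def IsDensityMatrix {d : ℕ} (ρ : Fock (Fin d) →L[ℂ] Fock (Fin d)) : Prop :=
  ρ.IsPositive ∧ LinearMap.trace ℂ (Fock (Fin d)) ρ.toLinearMap = 1

/-- The expectation `A ↦ tr(ρ A)`. -/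
def expectation {d : ℕ} (ρ A : Fock (Fin d) →L[ℂ] Fock (Fin d)) : ℂ :=
  LinearMap.trace ℂ (Fock (Fin d)) (ρ * A).toLinearMap

/-- The product functional `ω ⊗ ρ` on operators of the coupled system: with an orthonormal basis
`e` of the sample Fock space and the blocks `X_{ki} = ⟨e_k| X |e_i⟩` (operators of the reservoir),
`(ω ⊗ ρ)(X) = ∑_{i,k} ⟨e_i, ρ e_k⟩ ω(X_{ki})`. -/
def productState {d : ℕ} (ω : (Fock ℤ →L[ℂ] Fock ℤ) →ₗ[ℂ] ℂ)
    (ρ : Fock (Fin d) →L[ℂ] Fock (Fin d)) (X : System d →L[ℂ] System d) : ℂ :=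
  ∑ i, ∑ k, ⟪stdOrthonormalBasis ℂ (Fock (Fin d)) i,
      ρ (stdOrthonormalBasis ℂ (Fock (Fin d)) k)⟫_ℂ *
    ω (ContinuousLinearMap.adjoint (tensorRight (stdOrthonormalBasis ℂ (Fock (Fin d)) k)) ∘L X ∘L
      tensorRight (stdOrthonormalBasis ℂ (Fock (Fin d)) i))

/-- `(ω ⊗ ρ)(B ⊗ A) = ω(B) tr(ρ A)`. -/
lemma productState_tensor {d : ℕ} (ω : (Fock ℤ →L[ℂ] Fock ℤ) →ₗ[ℂ] ℂ)
    (ρ : Fock (Fin d) →L[ℂ] Fock (Fin d)) (B : Fock ℤ →L[ℂ] Fock ℤ)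
    (A : Fock (Fin d) →L[ℂ] Fock (Fin d)) :
    productState ω ρ (onReservoir B * onSample A) =
      ω B * expectation ρ A := by
  set e := stdOrthonormalBasis ℂ (Fock (Fin d)) with he
  have h1 : ∀ i k, ContinuousLinearMap.adjoint (tensorRight (e k)) ∘L
      (onReservoir B * onSample A) ∘L tensorRight (e i) = ⟪e k, A (e i)⟫_ℂ • B := by
    intro i k
    refine ContinuousLinearMap.ext fun ψ => ext_inner_left ℂ fun φ => ?_
    rw [ContinuousLinearMap.comp_apply, ContinuousLinearMap.adjoint_inner_right]
    change ⟪tensorRight (e k) φ, tensorRight (A (e i)) (B ψ)⟫_ℂ = ⟪φ, ⟪e k, A (e i)⟫_ℂ • B ψ⟫_ℂ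
    rw [inner_tensorRight, inner_smul_right, mul_comm]
  have h2 : expectation ρ A = ∑ i, ∑ k, ⟪e i, ρ (e k)⟫_ℂ * ⟪e k, A (e i)⟫_ℂ := by
    rw [expectation, LinearMap.trace_eq_sum_inner _ e]
    refine Finset.sum_congr rfl fun i _ => ?_
    have h3 : A (e i) = ∑ k, ⟪e k, A (e i)⟫_ℂ • e k := (e.sum_repr' _).symm
    change ⟪e i, ρ (A (e i))⟫_ℂ = _
    conv_lhs => rw [h3]
    rw [map_sum, inner_sum]
    refine Finset.sum_congr rfl fun k _ => ?_
    rw [map_smul, inner_smul_right, mul_comm]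
  rw [h2, Finset.mul_sum]
  refine Finset.sum_congr rfl fun i _ => ?_
  rw [Finset.mul_sum]
  refine Finset.sum_congr rfl fun k _ => ?_
  rw [← he, h1, map_smul, smul_eq_mul]
  ring

/-- The state of the sample at time `t`: `ρ_t(A) = (ω ⊗ ρ)(τ^t(1 ⊗ A))`. -/
def sampleState {d : ℕ} [NeZero d] (α : ℝ) (ω : (Fock ℤ →L[ℂ] Fock ℤ) →ₗ[ℂ] ℂ)
    (ρ : Fock (Fin d) →L[ℂ] Fock (Fin d)) (t : ℕ) (A : Fock (Fin d) →L[ℂ] Fock (Fin d)) : ℂ :=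
  productState ω ρ (evolve d α t (onSample A))

/-! ## Operators on `(ℂ^d)^{⊗ p}` and reduced density matrices -/

/-- Operators on `(ℂ^d)^{⊗ p}`, as matrices in the basis `e_{x 0} ⊗ ⋯ ⊗ e_{x (p-1)}`. -/
abbrev TensorOp (d p : ℕ) : Type := Matrix (Fin p → Fin d) (Fin p → Fin d) ℂ

/-- The projection `P_A^{(p)} = (1/p!) ∑_π sgn(π) Θ(π)` onto antisymmetric tensors, where
`Θ(π) u_1 ⊗ ⋯ ⊗ u_p = u_{π 1} ⊗ ⋯ ⊗ u_{π p}`. -/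
def antisymmetrizer (d p : ℕ) : TensorOp d p :=
  ((p.factorial : ℂ))⁻¹ • ∑ π : Equiv.Perm (Fin p),
    sgn π • Matrix.of fun x y : Fin p → Fin d => if x = y ∘ π then (1 : ℂ) else 0

/-- The elementary vector `e_{J 0} ∧ ⋯ ∧ e_{J (p-1)}
= (p!)^{-1/2} ∑_π sgn(π) e_{J (π 0)} ⊗ ⋯ ⊗ e_{J (π (p-1))}`. -/
def wedge {d p : ℕ} (J : Fin p → Fin d) (x : Fin p → Fin d) : ℂ :=
  ((Real.sqrt p.factorial : ℝ) : ℂ)⁻¹ * ∑ π : Equiv.Perm (Fin p), if x = J ∘ π then sgn π else 0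

open Classical in
/-- The `p`-body reduced density matrix of a functional `ν` on the observables of the sample:
the operator on antisymmetric tensors (extended by zero to `(ℂ^d)^{⊗ p}`) with matrix elements
`⟨e_{J 0} ∧ ⋯ ∧ e_{J (p-1)}, ρ^{(p)} e_{K 0} ∧ ⋯ ∧ e_{K (p-1)}⟩
  = ν(a^*_{K 0} ⋯ a^*_{K (p-1)} a_{J (p-1)} ⋯ a_{J 0})`
in the orthonormal basis of the `e_{J 0} ∧ ⋯ ∧ e_{J (p-1)}` with `J` strictly increasing. -/
def reducedDensity {d : ℕ} (ν : (Fock (Fin d) →L[ℂ] Fock (Fin d)) → ℂ) (p : ℕ) : TensorOp d p :=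
  ∑ J : Fin p → Fin d with StrictMono J, ∑ K : Fin p → Fin d with StrictMono K,
    ν ((List.ofFn fun i => create (K i)).prod * (List.ofFn fun i => annihilate (J i)).reverse.prod) •
      Matrix.vecMulVec (wedge J) (star (wedge K))

/-- `M ⊗ T ⊗ ⋯ ⊗ T` on `(ℂ^d)^{⊗ p}`, for `M` on `(ℂ^d)^{⊗ k}`, with `p - k` factors `T`. -/
def tensorPad {d k p : ℕ} (hk : k ≤ p) (M : TensorOp d k) (T : Matrix (Fin d) (Fin d) ℂ) :
    TensorOp d p :=
  Matrix.of fun x y => M (fun i => x (Fin.castLE hk i)) (fun i => y (Fin.castLE hk i)) *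
    ∏ i : Fin p with k ≤ i.1, T (x i) (y i)

end FermiWalk

end

noncomputable section
namespace FermiWalk

/-! ## The canonical anticommutation relations -/

lemma sgn_mul {p : ℕ} (π κ : Equiv.Perm (Fin p)) : sgn (π * κ) = sgn π * sgn κ := by
  simp [sgn]

lemma sgn_inv {p : ℕ} (π : Equiv.Perm (Fin p)) : sgn π⁻¹ = sgn π := by
  simp [sgn]

lemma sgn_mul_self {p : ℕ} (π : Equiv.Perm (Fin p)) : sgn π * sgn π = 1 := by
  rcases Int.units_eq_one_or (Equiv.Perm.sign π) with h | h <;> simp [sgn, h]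

open Classical in
/-- The vector of the full Fock space with coefficients `(p!)⁻¹ ∑_π sgn(π) δ_{x ∘ π}`. -/
def fullWedge {ι : Type} {p : ℕ} (x : Fin p → ι) : FullFock ι :=
  (p.factorial : ℂ)⁻¹ • ∑ π : Equiv.Perm (Fin p),
    sgn π • lp.single 2 (⟨p, x ∘ π⟩ : FockIndex ι) (1 : ℂ)

open Classical in
lemma fullWedge_apply {ι : Type} {p : ℕ} (x : Fin p → ι) (q : FockIndex ι) :
    fullWedge x q = (p.factorial : ℂ)⁻¹ * ∑ π : Equiv.Perm (Fin p),
      if q = ⟨p, x ∘ π⟩ then sgn π else 0 := by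
  simp only [fullWedge, lp.coeFn_smul, Pi.smul_apply, lp.coeFn_sum, Finset.sum_apply,
    smul_eq_mul, lp.single_apply]
  congr 1
  refine Finset.sum_congr rfl fun π _ => ?_
  by_cases h : q = ⟨p, x ∘ π⟩
  · subst h; simp
  · simp [h]

lemma fullWedge_apply_self {ι : Type} [DecidableEq ι] {p : ℕ} (x y : Fin p → ι) :
    fullWedge x ⟨p, y⟩ = (p.factorial : ℂ)⁻¹ *
      (Matrix.of fun i j => if y i = x j then (1 : ℂ) else 0).det := by
  classical
  rw [fullWedge_apply, Matrix.det_apply', ← Equiv.sum_comp (Equiv.inv _)]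
  congr 1
  refine Finset.sum_congr rfl fun π _ => ?_
  simp only [Matrix.of_apply, Finset.prod_ite_zero, Finset.prod_const_one, Finset.mem_univ,
    true_imp_iff, Sigma.mk.injEq, heq_eq_eq, true_and, mul_ite, mul_one, mul_zero,
    Equiv.inv_apply, sgn_inv]
  refine if_congr ?_ rfl rfl
  constructor
  · intro h i
    simp [h]
  · intro h
    funext i
    have := h (π⁻¹ i)
    simpa using this

lemma fullWedge_mem {ι : Type} {p : ℕ} (x : Fin p → ι) : fullWedge x ∈ antisymmetric ι := by
  classical
  intro q π y
  by_cases hq : q = p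
  · subst hq
    rw [fullWedge_apply_self, fullWedge_apply_self]
    have := Matrix.det_permute π (Matrix.of fun i j => if y i = x j then (1 : ℂ) else 0)
    rw [show (Matrix.of fun i j => if (y ∘ π) i = x j then (1 : ℂ) else 0) =
      (Matrix.of fun i j => if y i = x j then (1 : ℂ) else 0).submatrix π id from rfl, this, sgn]
    ring
  · have h : ∀ (z : Fin q → ι) (κ : Equiv.Perm (Fin p)),
        (⟨q, z⟩ : FockIndex ι) ≠ ⟨p, x ∘ κ⟩ := fun z κ hz => hq (congrArg Sigma.fst hz)
    simp [fullWedge_apply, h]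

/-- `(p!)^{-1/2} e_{x 0} ∧ ⋯ ∧ e_{x (p-1)}`, the orthogonal projection of
`e_{x 0} ⊗ ⋯ ⊗ e_{x (p-1)}` to Fock space. -/
def wedgeVec {ι : Type} {p : ℕ} (x : Fin p → ι) : Fock ι := ⟨fullWedge x, fullWedge_mem x⟩

lemma coeff_wedgeVec {ι : Type} [DecidableEq ι] {p : ℕ} (x y : Fin p → ι) :
    coeff (wedgeVec x) ⟨p, y⟩ = (p.factorial : ℂ)⁻¹ *
      (Matrix.of fun i j => if y i = x j then (1 : ℂ) else 0).det :=
  fullWedge_apply_self x y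

lemma coeff_wedgeVec_of_ne {ι : Type} {p q : ℕ} (hq : q ≠ p) (x : Fin p → ι) (y : Fin q → ι) :
    coeff (wedgeVec x) ⟨q, y⟩ = 0 := by
  classical
  have h : ∀ κ : Equiv.Perm (Fin p),
      (⟨q, y⟩ : FockIndex ι) ≠ ⟨p, x ∘ κ⟩ := fun κ hz => hq (congrArg Sigma.fst hz)
  change fullWedge x _ = 0
  simp [fullWedge_apply, h]

lemma inner_wedgeVec {ι : Type} {p : ℕ} (x : Fin p → ι) (f : Fock ι) :
    ⟪wedgeVec x, f⟫_ℂ = coeff f ⟨p, x⟩ := by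
  classical
  change ⟪fullWedge x, f.1⟫_ℂ = _
  have h : ∀ π : Equiv.Perm (Fin p),
      ⟪sgn π • (lp.single 2 (⟨p, x ∘ π⟩ : FockIndex ι) (1 : ℂ) : FullFock ι), f.1⟫_ℂ =
        coeff f ⟨p, x⟩ := by
    intro π
    rw [inner_smul_left, lp.inner_single_left]
    change _ * ⟪(1 : ℂ), coeff f ⟨p, x ∘ π⟩⟫_ℂ = _
    rw [coeff_perm]
    have : (starRingEnd ℂ) (sgn π) = sgn π := by simp [sgn]
    rw [this]
    simp [← mul_assoc, sgn_mul_self]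
  rw [fullWedge, inner_smul_left, sum_inner, Finset.sum_congr rfl fun π _ => h π]
  rw [Finset.sum_const, Finset.card_univ, Fintype.card_perm, Fintype.card_fin]
  simp only [map_inv₀, map_natCast, nsmul_eq_mul]
  field_simp

lemma coeff_annihilate {ι : Type} (j : ι) (f : Fock ι) {p : ℕ} (x : Fin p → ι) :
    coeff (annihilate j f) ⟨p, x⟩ =
      ((Real.sqrt (p + 1) : ℝ) : ℂ) * coeff f ⟨p + 1, Fin.cons j x⟩ := rfl

lemma sqrt_succ_mul_self (p : ℕ) :
    ((Real.sqrt (p + 1) : ℝ) : ℂ) * ((Real.sqrt (p + 1) : ℝ) : ℂ) = p + 1 := by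
  rw [← Complex.ofReal_mul, Real.mul_self_sqrt (by positivity)]
  push_cast
  rfl

lemma sqrt_succ_ne_zero (p : ℕ) : ((Real.sqrt (p + 1) : ℝ) : ℂ) ≠ 0 := by
  rw [Complex.ofReal_ne_zero]
  positivity

lemma annihilate_wedgeVec_zero {ι : Type} (j : ι) (x : Fin 0 → ι) :
    annihilate j (wedgeVec x) = 0 := by
  refine coeff_ext ?_
  rintro ⟨q, y⟩
  rw [coeff_annihilate, coeff_wedgeVec_of_ne (by omega), mul_zero]
  rfl

lemma coeff_sum {ι κ : Type} (s : Finset κ) (f : κ → Fock ι) (q : FockIndex ι) :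
    coeff (∑ i ∈ s, f i) q = ∑ i ∈ s, coeff (f i) q := by
  classical
  induction s using Finset.induction_on with
  | empty => rfl
  | insert a s ha ih => rw [Finset.sum_insert ha, Finset.sum_insert ha, coeff_add, ih]

lemma annihilate_wedgeVec_succ {ι : Type} [DecidableEq ι] (j : ι) {p : ℕ} (x : Fin (p + 1) → ι) :
    annihilate j (wedgeVec x) = ∑ r : Fin (p + 1),
      (((Real.sqrt (p + 1) : ℝ) : ℂ)⁻¹ * ((-1) ^ (r : ℕ) * if x r = j then 1 else 0)) •
        wedgeVec (x ∘ r.succAbove) := by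
  refine coeff_ext ?_
  rintro ⟨q, y⟩
  rw [coeff_annihilate, coeff_sum]
  by_cases hq : q = p
  · subst hq
    rw [coeff_wedgeVec, Matrix.det_succ_row_zero, Finset.mul_sum, Finset.mul_sum]
    refine Finset.sum_congr rfl fun r _ => ?_
    rw [coeff_smul, coeff_wedgeVec, Nat.factorial_succ]
    have h : (Matrix.of fun i k => if (Fin.cons j y : Fin (q + 1) → ι) i = x k then (1 : ℂ) else 0
        ).submatrix Fin.succ r.succAbove =
        Matrix.of fun i k => if y i = (x ∘ r.succAbove) k then (1 : ℂ) else 0 := by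
      ext i k
      simp
    rw [h]
    have h1 := sqrt_succ_mul_self q
    have h2 := sqrt_succ_ne_zero q
    simp only [Matrix.of_apply, Fin.cons_zero, eq_comm (a := j)]
    push_cast
    have h3 : ((q : ℂ) + 1) ≠ 0 := by exact_mod_cast q.succ_ne_zero
    have h4 : (q.factorial : ℂ) ≠ 0 := by exact_mod_cast q.factorial_ne_zero
    have h5 : ((Real.sqrt (q + 1) : ℝ) : ℂ) * ((q : ℂ) + 1)⁻¹ =
        ((Real.sqrt (q + 1) : ℝ) : ℂ)⁻¹ := by
      rw [← h1]; field_simp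
    rw [mul_inv, ← h5]
    ring
  · rw [coeff_wedgeVec_of_ne (by omega), mul_zero]
    refine (Finset.sum_eq_zero fun r _ => ?_).symm
    rw [coeff_smul, coeff_wedgeVec_of_ne hq, mul_zero]

lemma coeff_create_zero {ι : Type} (j : ι) (f : Fock ι) (x : Fin 0 → ι) :
    coeff (create j f) ⟨0, x⟩ = 0 := by
  rw [← inner_wedgeVec, create, ContinuousLinearMap.adjoint_inner_right,
    annihilate_wedgeVec_zero, inner_zero_left]

lemma coeff_create_succ {ι : Type} [DecidableEq ι] (j : ι) (f : Fock ι) {p : ℕ}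
    (x : Fin (p + 1) → ι) :
    coeff (create j f) ⟨p + 1, x⟩ = ∑ r : Fin (p + 1),
      (((Real.sqrt (p + 1) : ℝ) : ℂ)⁻¹ * ((-1) ^ (r : ℕ) * if x r = j then 1 else 0)) *
        coeff f ⟨p, x ∘ r.succAbove⟩ := by
  rw [← inner_wedgeVec, create, ContinuousLinearMap.adjoint_inner_right,
    annihilate_wedgeVec_succ, sum_inner]
  refine Finset.sum_congr rfl fun r _ => ?_
  rw [inner_smul_left, inner_wedgeVec]
  congr 1
  simp [apply_ite (starRingEnd ℂ)]

lemma annihilate_mul_annihilate {ι : Type} (i j : ι) :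
    annihilate i * annihilate j = -(annihilate j * annihilate i) := by
  refine ContinuousLinearMap.ext fun f => coeff_ext ?_
  rintro ⟨p, x⟩
  have h : (Fin.cons j (Fin.cons i x : Fin (p + 1) → ι) : Fin (p + 2) → ι) =
      (Fin.cons i (Fin.cons j x : Fin (p + 1) → ι) : Fin (p + 2) → ι) ∘ Equiv.swap 0 1 := by
    funext k
    refine Fin.cases ?_ (fun k => Fin.cases ?_ (fun k => ?_) k) k
    · simp
    · simp
    · rw [Function.comp_apply, Equiv.swap_apply_of_ne_of_ne]
      · rfl
      · exact Fin.succ_ne_zero _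
      · rw [← Fin.succ_zero_eq_one]
        exact fun h => Fin.succ_ne_zero _ (Fin.succ_injective _ h)
  have hs : sgn (Equiv.swap (0 : Fin (p + 2)) 1) = -1 := by
    simp [sgn]
  change coeff (annihilate i (annihilate j f)) _ = coeff (-(annihilate j (annihilate i f))) _
  rw [← neg_one_smul ℂ, coeff_smul, coeff_annihilate, coeff_annihilate, coeff_annihilate,
    coeff_annihilate, h, coeff_perm, hs]
  ring

lemma create_mul_create {ι : Type} (i j : ι) :
    create i * create j = -(create j * create i) := by
  have h := congrArg star (annihilate_mul_annihilate j i)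
  rwa [star_mul, star_neg, star_mul] at h

lemma annihilate_mul_create {ι : Type} [DecidableEq ι] (i j : ι) :
    annihilate i * create j = (if i = j then 1 else 0) - create j * annihilate i := by
  rw [eq_sub_iff_add_eq]
  refine ContinuousLinearMap.ext fun f => coeff_ext ?_
  rintro ⟨p, x⟩
  have h1 : coeff (annihilate i (create j f)) ⟨p, x⟩ =
      (if i = j then 1 else 0) * coeff f ⟨p, x⟩ -
        ∑ r : Fin p, ((-1) ^ (r : ℕ) * if x r = j then 1 else 0) *
          coeff f ⟨p, (Fin.cons i x : Fin (p + 1) → ι) ∘ r.succ.succAbove⟩ := by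
    have h2 := sqrt_succ_ne_zero p
    rw [coeff_annihilate, coeff_create_succ, Finset.mul_sum, Fin.sum_univ_succ, sub_eq_add_neg,
      ← Finset.sum_neg_distrib]
    congr 1
    · have h : (Fin.cons i x : Fin (p + 1) → ι) ∘ Fin.succAbove 0 = x := by
        funext k; simp
      rw [h, Fin.cons_zero]
      field_simp
      simp
    · refine Finset.sum_congr rfl fun r _ => ?_
      rw [Fin.cons_succ, Fin.val_succ, pow_succ]
      field_simp
  have h3 : coeff (create j (annihilate i f)) ⟨p, x⟩ =
      ∑ r : Fin p, ((-1) ^ (r : ℕ) * if x r = j then 1 else 0) *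
          coeff f ⟨p, (Fin.cons i x : Fin (p + 1) → ι) ∘ r.succ.succAbove⟩ := by
    cases p with
    | zero => rw [coeff_create_zero]; simp
    | succ p =>
      have h2 := sqrt_succ_ne_zero p
      rw [coeff_create_succ]
      refine Finset.sum_congr rfl fun r _ => ?_
      have h : (Fin.cons i x : Fin (p + 2) → ι) ∘ r.succ.succAbove =
          Fin.cons i (x ∘ r.succAbove) := by
        funext k
        refine Fin.cases ?_ (fun k => ?_) k <;> simp
      rw [coeff_annihilate, h]
      field_simp
  change coeff (annihilate i (create j f) + create j (annihilate i f)) _ = _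
  rw [coeff_add, h1, h3, sub_add_cancel]
  split_ifs
  · simp
  · simp only [zero_mul]; rfl


/-! ## Second quantization -/

lemma coeff_secondQuant {ι : Type} (τ : Equiv.Perm ι) (f : Fock ι) {p : ℕ} (x : Fin p → ι) :
    coeff (secondQuant τ f) ⟨p, x⟩ = coeff f ⟨p, τ.symm ∘ x⟩ := rfl

lemma norm_contraction_le {ι : Type} (T : Fock ι → FockIndex ι → ℂ) (hadd hsmul hanti)
    (hbound : ∀ f (s : Finset (FockIndex ι)), ∑ q ∈ s, ‖T f q‖ ^ 2 ≤ ‖f‖ ^ 2) (f : Fock ι) :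
    ‖contraction T hadd hsmul hanti hbound f‖ ≤ ‖f‖ := by
  refine lp.norm_le_of_forall_sum_le (p := 2) (by norm_num) (norm_nonneg _) fun s => ?_
  simp only [ENNReal.toReal_ofNat, Real.rpow_ofNat]
  exact hbound f s

lemma norm_secondQuant_le {ι : Type} (τ : Equiv.Perm ι) (f : Fock ι) :
    ‖secondQuant τ f‖ ≤ ‖f‖ :=
  norm_contraction_le _ _ _ _ _ f

lemma secondQuant_symm_apply {ι : Type} (τ : Equiv.Perm ι) (f : Fock ι) :
    secondQuant τ.symm (secondQuant τ f) = f := by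
  refine coeff_ext ?_
  rintro ⟨p, x⟩
  rw [coeff_secondQuant, coeff_secondQuant]
  congr 2
  funext i
  simp

lemma star_secondQuant_mul_self {ι : Type} (τ : Equiv.Perm ι) :
    star (secondQuant τ) * secondQuant τ = 1 := by
  refine (ContinuousLinearMap.norm_map_iff_adjoint_comp_self _).1 fun f => ?_
  refine le_antisymm (norm_secondQuant_le τ f) ?_
  conv_lhs => rw [← secondQuant_symm_apply τ f]
  exact norm_secondQuant_le _ _

lemma secondQuant_mul_star_self {ι : Type} (τ : Equiv.Perm ι) :
    secondQuant τ * star (secondQuant τ) = 1 := by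
  have h : secondQuant τ * secondQuant τ.symm = 1 :=
    ContinuousLinearMap.ext fun f => secondQuant_symm_apply τ.symm f
  have h2 : star (secondQuant τ) = secondQuant τ.symm := by
    rw [← mul_one (star (secondQuant τ)), ← h, ← mul_assoc, star_secondQuant_mul_self, one_mul]
  rw [h2, h]

lemma star_secondQuant_annihilate {ι : Type} (τ : Equiv.Perm ι) (j : ι) :
    star (secondQuant τ) * annihilate j * secondQuant τ = annihilate (τ.symm j) := by
  have h : annihilate j * secondQuant τ = secondQuant τ * annihilate (τ.symm j) := by
    refine ContinuousLinearMap.ext fun f => coeff_ext ?_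
    rintro ⟨p, x⟩
    change coeff (annihilate j (secondQuant τ f)) _ = coeff (secondQuant τ (annihilate _ f)) _
    rw [coeff_annihilate, coeff_secondQuant, coeff_secondQuant, coeff_annihilate]
    congr 3
    funext i
    refine Fin.cases ?_ (fun k => ?_) i <;> simp
  rw [mul_assoc, h, ← mul_assoc, star_secondQuant_mul_self, one_mul]

lemma star_annihilate {ι : Type} (j : ι) : star (annihilate j) = create j := rfl

lemma star_create {ι : Type} (j : ι) : star (create j) = annihilate j :=
  star_star (annihilate j)

lemma star_secondQuant_create {ι : Type} (τ : Equiv.Perm ι) (j : ι) :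
    star (secondQuant τ) * create j * secondQuant τ = create (τ.symm j) := by
  have h := congrArg star (star_secondQuant_annihilate τ j)
  rwa [star_mul, star_mul, star_star, star_annihilate, star_annihilate, ← mul_assoc] at h

/-! ## Operators of the coupled system -/

section Tensor
variable {d : ℕ}

lemma onReservoir_mul (B C : Fock ℤ →L[ℂ] Fock ℤ) :
    onReservoir (d := d) (B * C) = onReservoir B * onReservoir C :=
  ContinuousLinearMap.rTensor_mul _ B C

lemma onSample_mul (A C : Fock (Fin d) →L[ℂ] Fock (Fin d)) :
    onSample (A * C) = onSample A * onSample C :=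
  ContinuousLinearMap.lTensor_mul _ A C

lemma onReservoir_one : onReservoir (d := d) 1 = 1 := ContinuousLinearMap.rTensor_one _

lemma onSample_one : onSample (d := d) 1 = 1 := ContinuousLinearMap.lTensor_one _

lemma onReservoir_smul (c : ℂ) (B : Fock ℤ →L[ℂ] Fock ℤ) :
    onReservoir (d := d) (c • B) = c • onReservoir B :=
  ContinuousLinearMap.rTensor_smul _ c B

lemma onReservoir_sub (B C : Fock ℤ →L[ℂ] Fock ℤ) :
    onReservoir (d := d) (B - C) = onReservoir B - onReservoir C :=
  ContinuousLinearMap.rTensor_sub _ B C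

lemma onSample_add (A C : Fock (Fin d) →L[ℂ] Fock (Fin d)) :
    onSample (A + C) = onSample A + onSample C :=
  ContinuousLinearMap.lTensor_add _ A C

lemma onSample_sub (A C : Fock (Fin d) →L[ℂ] Fock (Fin d)) :
    onSample (A - C) = onSample A - onSample C :=
  ContinuousLinearMap.lTensor_sub _ A C

lemma onSample_smul (c : ℂ) (A : Fock (Fin d) →L[ℂ] Fock (Fin d)) :
    onSample (c • A) = c • onSample A :=
  ContinuousLinearMap.lTensor_smul _ c A

lemma system_ext {X Y : System d →L[ℂ] System d}
    (h : ∀ φ v, X (tensorRight v φ) = Y (tensorRight v φ)) : X = Y := by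
  refine ContinuousLinearMap.coe_injective (TensorProduct.ext' fun φ v => ?_)
  exact h φ v

lemma onSample_mul_onReservoir (A : Fock (Fin d) →L[ℂ] Fock (Fin d)) (B : Fock ℤ →L[ℂ] Fock ℤ) :
    onSample A * onReservoir B = onReservoir B * onSample A :=
  system_ext fun _ _ => rfl

lemma inner_ext {x y : System d} (h : ∀ φ v, ⟪tensorRight v φ, x⟫_ℂ = ⟪tensorRight v φ, y⟫_ℂ) :
    x = y := by
  refine ext_inner_left ℂ fun z => ?_
  refine TensorProduct.induction_on (motive := fun z : Fock ℤ ⊗[ℂ] Fock (Fin d) =>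
    ⟪(z : System d), x⟫_ℂ = ⟪(z : System d), y⟫_ℂ) z ?_ (fun φ v => h φ v) ?_
  · exact (inner_zero_left (E := System d) _).trans (inner_zero_left (E := System d) _).symm
  · intro z w hz hw
    exact (inner_add_left (E := System d) _ _ _).trans
      ((congrArg₂ (· + ·) hz hw).trans (inner_add_left (E := System d) _ _ _).symm)

lemma star_onReservoir (B : Fock ℤ →L[ℂ] Fock ℤ) :
    star (onReservoir (d := d) B) = onReservoir (star B) := by
  refine system_ext fun φ v => inner_ext fun ψ w => ?_
  rw [ContinuousLinearMap.star_eq_adjoint, ContinuousLinearMap.adjoint_inner_right,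
    onReservoir_tensorRight, onReservoir_tensorRight, inner_tensorRight, inner_tensorRight,
    ContinuousLinearMap.star_eq_adjoint, ContinuousLinearMap.adjoint_inner_right]

lemma star_onSample (A : Fock (Fin d) →L[ℂ] Fock (Fin d)) :
    star (onSample A) = onSample (star A) := by
  refine system_ext fun φ v => inner_ext fun ψ w => ?_
  rw [ContinuousLinearMap.star_eq_adjoint, ContinuousLinearMap.adjoint_inner_right,
    onSample_tensorRight, onSample_tensorRight, inner_tensorRight, inner_tensorRight,
    ContinuousLinearMap.star_eq_adjoint, ContinuousLinearMap.adjoint_inner_right]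

end Tensor

/-! ## The coupling -/

lemma exp_smul_of_pow_three {A : Type*} [NormedRing A] [NormedAlgebra ℂ A] [CompleteSpace A]
    (V : A) (hV : V ^ 3 = V) (z : ℂ) :
    NormedSpace.exp (z • V) = 1 + (Complex.cosh z - 1) • V ^ 2 + Complex.sinh z • V := by
  have hP : ∀ n : ℕ, V ^ (2 * n + 1) = V ∧ V ^ (2 * n + 2) = V ^ 2 := by
    intro n
    induction n with
    | zero => simp
    | succ n ih =>
      have h1 : V ^ (2 * (n + 1) + 1) = V := by
        rw [show 2 * (n + 1) + 1 = (2 * n + 1) + 2 by ring, pow_add, ih.1, ← pow_succ', hV]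
      refine ⟨h1, ?_⟩
      rw [show 2 * (n + 1) + 2 = (2 * (n + 1) + 1) + 1 by ring, pow_succ, h1, sq]
  have hpow : ∀ n : ℕ, (n.factorial : ℂ)⁻¹ • (z • V) ^ n =
      ((n.factorial : ℂ)⁻¹ * z ^ n) • ((1 / 2 : ℂ) • (V ^ 2 + V)) +
      ((n.factorial : ℂ)⁻¹ * (-z) ^ n) • ((1 / 2 : ℂ) • (V ^ 2 - V)) +
      ((n.factorial : ℂ)⁻¹ * 0 ^ n) • (1 - V ^ 2) := by
    intro n
    rw [smul_pow, smul_smul]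
    rcases Nat.even_or_odd' n with ⟨k, rfl | rfl⟩
    · rcases k with _ | k
      · simp only [mul_zero, pow_zero, mul_one, Nat.factorial_zero, Nat.cast_one, inv_one]
        module
      · rw [show 2 * (k + 1) = 2 * k + 2 by ring, (hP k).2,
          Even.neg_pow ⟨k + 1, by ring⟩, zero_pow (by omega)]
        module
    · rw [(hP k).1, Odd.neg_pow ⟨k, rfl⟩, zero_pow (by omega)]
      module
  have hs : ∀ w : ℂ, HasSum (fun n : ℕ => (n.factorial : ℂ)⁻¹ * w ^ n) (Complex.exp w) := by
    intro w
    have := NormedSpace.exp_series_hasSum_exp' (𝕂 := ℂ) w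
    rw [Complex.exp_eq_exp_ℂ]
    exact this
  have hsum := (((hs z).smul_const ((1 / 2 : ℂ) • (V ^ 2 + V))).add
    ((hs (-z)).smul_const ((1 / 2 : ℂ) • (V ^ 2 - V)))).add ((hs 0).smul_const (1 - V ^ 2))
  have hexp := NormedSpace.exp_series_hasSum_exp' (𝕂 := ℂ) (z • V)
  rw [hexp.unique ((funext hpow ▸ hsum)), Complex.exp_zero, Complex.cosh, Complex.sinh]
  module

section Coupling
/-- The number operator `c_j^* c_j`. -/
def number {ι : Type} (j : ι) : Fock ι →L[ℂ] Fock ι := create j * annihilate j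

variable {ι : Type} (i j : ι)

lemma annihilate_mul_self : annihilate i * annihilate i = 0 := by
  have h := annihilate_mul_annihilate i i
  rwa [eq_neg_iff_add_eq_zero, ← two_smul ℂ, smul_eq_zero_iff_right two_ne_zero] at h

lemma create_mul_self : create i * create i = 0 := by
  have h := congrArg star (annihilate_mul_self i)
  rwa [star_mul, star_zero] at h

lemma annihilate_mul_create_self : annihilate i * create i = 1 - number i := by
  classical
  rw [annihilate_mul_create, if_pos rfl, number]

lemma create_mul_annihilate_self : create i * annihilate i = number i := rfl

lemma annihilate_mul_number : annihilate i * number i = annihilate i := by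
  rw [number, ← mul_assoc, annihilate_mul_create_self, number, sub_mul, one_mul, mul_assoc,
    annihilate_mul_self, mul_zero, sub_zero]

lemma number_mul_annihilate : number i * annihilate i = 0 := by
  rw [number, mul_assoc, annihilate_mul_self, mul_zero]

lemma create_mul_number : create i * number i = 0 := by
  rw [number, ← mul_assoc, create_mul_self, zero_mul]

lemma number_mul_create : number i * create i = create i := by
  rw [number, mul_assoc, annihilate_mul_create_self, mul_sub, mul_one, create_mul_number, sub_zero]

lemma number_mul_self : number i * number i = number i := by
  conv_lhs => enter [2]; rw [number]
  rw [← mul_assoc, number_mul_create, number]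

end Coupling

section Kick
variable {d : ℕ}

/-- The operator `B ⊗ A` of the coupled system. -/
def tens (B : Fock ℤ →L[ℂ] Fock ℤ) (A : Fock (Fin d) →L[ℂ] Fock (Fin d)) :
    System d →L[ℂ] System d := onReservoir B * onSample A

lemma tens_mul (B C : Fock ℤ →L[ℂ] Fock ℤ) (A D : Fock (Fin d) →L[ℂ] Fock (Fin d)) :
    tens B A * tens C D = tens (B * C) (A * D) := by
  simp only [tens, onReservoir_mul, onSample_mul]
  rw [mul_assoc, ← mul_assoc (onSample A), onSample_mul_onReservoir]
  simp only [mul_assoc]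

lemma tens_sub_left (B C : Fock ℤ →L[ℂ] Fock ℤ) (A : Fock (Fin d) →L[ℂ] Fock (Fin d)) :
    tens (B - C) A = tens B A - tens C A := by
  rw [tens, onReservoir_sub, sub_mul]; rfl

lemma tens_smul_left (c : ℂ) (B : Fock ℤ →L[ℂ] Fock ℤ) (A : Fock (Fin d) →L[ℂ] Fock (Fin d)) :
    tens (c • B) A = c • tens B A := by
  rw [tens, onReservoir_smul, smul_mul_assoc]; rfl

lemma tens_add_right (B : Fock ℤ →L[ℂ] Fock ℤ) (A D : Fock (Fin d) →L[ℂ] Fock (Fin d)) :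
    tens B (A + D) = tens B A + tens B D := by
  rw [tens, onSample_add, mul_add]; rfl

lemma tens_sub_right (B : Fock ℤ →L[ℂ] Fock ℤ) (A D : Fock (Fin d) →L[ℂ] Fock (Fin d)) :
    tens B (A - D) = tens B A - tens B D := by
  rw [tens, onSample_sub, mul_sub]; rfl

lemma tens_smul_right (c : ℂ) (B : Fock ℤ →L[ℂ] Fock ℤ) (A : Fock (Fin d) →L[ℂ] Fock (Fin d)) :
    tens B (c • A) = c • tens B A := by
  rw [tens, onSample_smul, mul_smul_comm]; rfl

lemma tens_zero_left (A : Fock (Fin d) →L[ℂ] Fock (Fin d)) : tens 0 A = 0 := by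
  have := tens_smul_left 0 0 A
  simpa using this

lemma tens_one_one : tens (d := d) 1 1 = 1 := by
  rw [tens, onReservoir_one, onSample_one, one_mul]

lemma tens_one_left (A : Fock (Fin d) →L[ℂ] Fock (Fin d)) : tens 1 A = onSample A := by
  rw [tens, onReservoir_one, one_mul]

lemma star_tens (B : Fock ℤ →L[ℂ] Fock ℤ) (A : Fock (Fin d) →L[ℂ] Fock (Fin d)) :
    star (tens B A) = tens (star B) (star A) := by
  rw [tens, star_mul, star_onReservoir, star_onSample, onSample_mul_onReservoir, tens]

variable [NeZero d]

variable (d) in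
/-- The hopping operator `b₀^* ⊗ a₀ + b₀ ⊗ a₀^*`. -/
def hop : System d →L[ℂ] System d :=
  tens (create 0) (annihilate 0) + tens (annihilate 0) (create 0)

lemma hop_sq : hop d ^ 2 = tens (number 0) (1 - number 0) + tens (1 - number 0) (number 0) := by
  simp only [hop, sq, add_mul, mul_add, tens_mul, create_mul_self, annihilate_mul_self,
    tens_zero_left, annihilate_mul_create_self, create_mul_annihilate_self]
  abel

lemma hop_pow_three : hop d ^ 3 = hop d := by
  rw [pow_succ, hop_sq, hop]
  simp only [add_mul, mul_add, tens_mul, sub_mul, one_mul, number_mul_create,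
    number_mul_annihilate, sub_self, tens_zero_left, sub_zero]
  simp only [tens, add_zero, zero_add]

variable (d) in
/-- The operator `1 + (c - 1) V² + z V`, where `V` is the hopping operator. -/
def kick (c z : ℂ) : System d →L[ℂ] System d := 1 + (c - 1) • hop d ^ 2 + z • hop d

lemma coupling_eq_kick (α : ℝ) :
    coupling d α = kick d (Real.cos α) (-(Complex.I * Real.sin α)) := by
  have h : coupling d α = NormedSpace.exp ((-(Complex.I * (α : ℂ))) • hop d) := rfl
  rw [h, exp_smul_of_pow_three _ hop_pow_three, kick, Complex.cosh_neg, Complex.sinh_neg,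
    mul_comm Complex.I, Complex.cosh_mul_I, Complex.sinh_mul_I, Complex.ofReal_cos,
    Complex.ofReal_sin, mul_comm Complex.I]

lemma star_hop : star (hop d) = hop d := by
  rw [hop, star_add, star_tens, star_tens, star_create, star_annihilate, star_annihilate,
    star_create, add_comm]

lemma star_kick (c z : ℂ) : star (kick d c z) = kick d (star c) (star z) := by
  simp only [kick, star_add, star_smul, star_pow, star_hop, star_one, star_sub]

/-- The part `1 + (c - 1) a^* a` of the coupling. -/
def damp (j : Fin d) (c : ℂ) : Fock (Fin d) →L[ℂ] Fock (Fin d) := 1 + (c - 1) • number j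

lemma kick_eq (c z : ℂ) : kick d c z = tens 1 (damp 0 c) +
    tens (number 0) ((c - 1) • (1 - (2 : ℂ) • number 0)) +
    z • tens (create 0) (annihilate 0) + z • tens (annihilate 0) (create 0) := by
  rw [kick, hop_sq, hop, damp, ← tens_one_one]
  simp only [tens_add_right, tens_sub_left, tens_sub_right, tens_smul_right]
  module

lemma kick_mul_tens_mul_kick (c z w : ℂ) (A : Fock (Fin d) →L[ℂ] Fock (Fin d)) :
    ∃ C₂ C₃ : Fock (Fin d) →L[ℂ] Fock (Fin d), kick d c z * tens 1 A * kick d c w =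
      tens 1 (damp 0 c * A * damp 0 c + (z * w) • (create 0 * A * annihilate 0)) +
      tens (number 0) ((damp 0 c + (c - 1) • (1 - (2 : ℂ) • number 0)) * A *
        (damp 0 c + (c - 1) • (1 - (2 : ℂ) • number 0)) - damp 0 c * A * damp 0 c +
        (z * w) • (annihilate 0 * A * create 0 - create 0 * A * annihilate 0)) +
      tens (annihilate 0) C₂ + tens (create 0) C₃ := by
  rw [kick_eq, kick_eq]
  generalize damp (0 : Fin d) c = k
  generalize (c - 1) • (1 - (2 : ℂ) • number (0 : Fin d)) = l
  refine ⟨w • (k * A * create 0) + z • (create 0 * A * k) + z • (create 0 * A * l),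
    w • (k * A * annihilate 0) + w • (l * A * annihilate 0) + z • (annihilate 0 * A * k), ?_⟩
  simp only [add_mul, mul_add, smul_mul_assoc, mul_smul_comm, tens_mul, one_mul, mul_one,
    number_mul_self, number_mul_create, number_mul_annihilate, create_mul_number,
    annihilate_mul_number, create_mul_self, annihilate_mul_self, create_mul_annihilate_self,
    annihilate_mul_create_self, tens_zero_left, tens_sub_left, tens_add_right, tens_sub_right,
    tens_smul_right, smul_zero]
  module

lemma kick_mul_tens_of_anticomm (c z : ℂ) (ε : ℂ) (hε : ε * ε = 1) (W : Fock ℤ →L[ℂ] Fock ℤ)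
    (ha : annihilate 0 * W = ε • (W * annihilate 0)) (hc : create 0 * W = ε • (W * create 0)) :
    kick d c z * tens W 1 = tens W 1 * kick d c (ε * z) := by
  have h1 : hop d * tens W 1 = ε • (tens W 1 * hop d) := by
    simp only [hop, add_mul, mul_add, tens_mul, ha, hc, tens_smul_left, mul_one, one_mul, smul_add]
  have h2 : hop d ^ 2 * tens W 1 = tens W 1 * hop d ^ 2 := by
    rw [sq, mul_assoc, h1, mul_smul_comm, ← mul_assoc, h1, smul_mul_assoc, smul_smul, hε, one_smul,
      mul_assoc]
  simp only [kick, add_mul, mul_add, smul_mul_assoc, mul_smul_comm, h1, h2, one_mul, mul_one,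
    smul_smul, mul_comm]

end Kick

/-! ## The partial expectation over the reservoir -/

section PartialExpectation
variable {d : ℕ} (ω : (Fock ℤ →L[ℂ] Fock ℤ) →ₗ[ℂ] ℂ)

/-- The partial expectation `B ⊗ A ↦ ω(B) A`. -/
def partialExp : (System d →L[ℂ] System d) →ₗ[ℂ] (Fock (Fin d) →L[ℂ] Fock (Fin d)) where
  toFun X := ∑ i, ∑ k, ω (ContinuousLinearMap.adjoint
      (tensorRight (stdOrthonormalBasis ℂ (Fock (Fin d)) k)) ∘L X ∘L
        tensorRight (stdOrthonormalBasis ℂ (Fock (Fin d)) i)) •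
      (innerSL ℂ (stdOrthonormalBasis ℂ (Fock (Fin d)) i)).smulRight
        (stdOrthonormalBasis ℂ (Fock (Fin d)) k)
  map_add' X Y := by
    simp only [ContinuousLinearMap.add_comp, ContinuousLinearMap.comp_add, map_add, add_smul,
      Finset.sum_add_distrib]
  map_smul' c X := by
    simp only [ContinuousLinearMap.smul_comp, ContinuousLinearMap.comp_smul, map_smul,
      smul_assoc, Finset.smul_sum, RingHom.id_apply]

lemma partialExp_tens (B : Fock ℤ →L[ℂ] Fock ℤ) (A : Fock (Fin d) →L[ℂ] Fock (Fin d)) :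
    partialExp ω (tens B A) = ω B • A := by
  set e := stdOrthonormalBasis ℂ (Fock (Fin d)) with he
  have h1 : ∀ i k, ContinuousLinearMap.adjoint (tensorRight (e k)) ∘L
      tens B A ∘L tensorRight (e i) = ⟪e k, A (e i)⟫_ℂ • B := by
    intro i k
    refine ContinuousLinearMap.ext fun ψ => ext_inner_left ℂ fun φ => ?_
    rw [ContinuousLinearMap.comp_apply, ContinuousLinearMap.adjoint_inner_right]
    change ⟪tensorRight (e k) φ, tensorRight (A (e i)) (B ψ)⟫_ℂ = ⟪φ, ⟪e k, A (e i)⟫_ℂ • B ψ⟫_ℂ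
    rw [inner_tensorRight, inner_smul_right, mul_comm]
  refine ContinuousLinearMap.ext fun v => ?_
  simp only [partialExp, LinearMap.coe_mk, AddHom.coe_mk, ← he, h1, map_smul, smul_eq_mul,
    sum_apply, smul_apply,
    ContinuousLinearMap.smulRight_apply, innerSL_apply_apply]
  conv_rhs => rw [← e.sum_repr' v, map_sum, Finset.smul_sum]
  refine Finset.sum_congr rfl fun i _ => ?_
  rw [map_smul]
  conv_rhs => rw [← e.sum_repr' (A (e i)), Finset.smul_sum, Finset.smul_sum]
  refine Finset.sum_congr rfl fun k _ => ?_
  simp only [smul_smul]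
  congr 1
  ring

/-- `expectation ρ` as a linear functional. -/
def expectationₗ (ρ : Fock (Fin d) →L[ℂ] Fock (Fin d)) :
    (Fock (Fin d) →L[ℂ] Fock (Fin d)) →ₗ[ℂ] ℂ where
  toFun A := expectation ρ A
  map_add' A B := by simp [expectation, mul_add]
  map_smul' c A := by simp [expectation]

lemma productState_eq_expectation (ρ : Fock (Fin d) →L[ℂ] Fock (Fin d))
    (X : System d →L[ℂ] System d) :
    productState ω ρ X = expectation ρ (partialExp ω X) := by
  set e := stdOrthonormalBasis ℂ (Fock (Fin d)) with he
  have h : ∀ i k, expectationₗ ρ ((innerSL ℂ (e i)).smulRight (e k)) = ⟪e i, ρ (e k)⟫_ℂ := by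
    intro i k
    change LinearMap.trace ℂ (Fock (Fin d)) _ = _
    rw [LinearMap.trace_eq_sum_inner _ e, Finset.sum_eq_single i]
    · change ⟪e i, ρ (⟪e i, e i⟫_ℂ • e k)⟫_ℂ = _
      simp
    · intro l _ hl
      change ⟪e l, ρ (⟪e i, e l⟫_ℂ • e k)⟫_ℂ = _
      rw [e.inner_eq_zero hl.symm]
      simp
    · simp
  change _ = expectationₗ ρ (partialExp ω X)
  simp only [partialExp, LinearMap.coe_mk, AddHom.coe_mk, map_sum, map_smul, ← he, h, productState,
    smul_eq_mul]
  refine Finset.sum_congr rfl fun i _ => Finset.sum_congr rfl fun k _ => mul_comm _ _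

end PartialExpectation

/-! ## Normally ordered monomials of the reservoir -/

/-- `b^*_{φ_m} ⋯ b^*_{φ_1} b_{ψ_1} ⋯ b_{ψ_n}`. -/
def mono (φ ψ : List ℤ) : Fock ℤ →L[ℂ] Fock ℤ :=
  (φ.map create).reverse.prod * (ψ.map annihilate).prod

lemma list_prod_mul_of_anticomm {R : Type*} [Ring R] [Algebra ℂ R] (x : R) (l : List R)
    (h : ∀ y ∈ l, x * y = -(y * x)) : x * l.prod = (-1 : ℂ) ^ l.length • (l.prod * x) := by
  induction l with
  | nil => simp
  | cons y l ih =>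
    rw [List.prod_cons, ← mul_assoc, h y (by simp), neg_mul, mul_assoc,
      ih fun z hz => h z (by simp [hz]), List.length_cons, pow_succ, mul_smul_comm, mul_assoc]
    module

lemma annihilate_mul_mono {j : ℤ} {φ : List ℤ} (hφ : j ∉ φ) (ψ : List ℤ) :
    annihilate j * mono φ ψ = (-1 : ℂ) ^ (φ.length + ψ.length) • (mono φ ψ * annihilate j) := by
  have h1 := list_prod_mul_of_anticomm (annihilate j) (φ.map create).reverse (by
    intro y hy
    simp only [List.mem_reverse, List.mem_map] at hy
    obtain ⟨i, hi, rfl⟩ := hy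
    rw [annihilate_mul_create, if_neg (by rintro rfl; exact hφ hi), zero_sub])
  have h2 := list_prod_mul_of_anticomm (annihilate j) (ψ.map annihilate) (by
    intro y hy
    simp only [List.mem_map] at hy
    obtain ⟨i, hi, rfl⟩ := hy
    exact annihilate_mul_annihilate _ _)
  rw [mono, ← mul_assoc, h1, smul_mul_assoc, mul_assoc, h2, mul_smul_comm, smul_smul, ← pow_add,
    mul_assoc]
  simp

lemma create_mul_mono {j : ℤ} (φ : List ℤ) {ψ : List ℤ} (hψ : j ∉ ψ) :
    create j * mono φ ψ = (-1 : ℂ) ^ (φ.length + ψ.length) • (mono φ ψ * create j) := by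
  have h1 := list_prod_mul_of_anticomm (create j) (φ.map create).reverse (by
    intro y hy
    simp only [List.mem_reverse, List.mem_map] at hy
    obtain ⟨i, hi, rfl⟩ := hy
    exact create_mul_create _ _)
  have h2 := list_prod_mul_of_anticomm (create j) (ψ.map annihilate) (by
    intro y hy
    simp only [List.mem_map] at hy
    obtain ⟨i, hi, rfl⟩ := hy
    rw [annihilate_mul_create, if_neg (by rintro rfl; exact hψ hi), zero_sub, neg_neg])
  rw [mono, ← mul_assoc, h1, smul_mul_assoc, mul_assoc, h2, mul_smul_comm, smul_smul, ← pow_add,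
    mul_assoc]
  simp

lemma neg_one_pow_mul_self (n : ℕ) : (-1 : ℂ) ^ n * (-1) ^ n = 1 := by
  rw [← pow_add, Even.neg_one_pow ⟨n, rfl⟩]

lemma mono_mul_annihilate (j : ℤ) (φ ψ : List ℤ) :
    mono φ ψ * annihilate j = (-1 : ℂ) ^ ψ.length • mono φ (j :: ψ) := by
  have h2 := list_prod_mul_of_anticomm (annihilate j) (ψ.map annihilate) (by
    intro y hy
    simp only [List.mem_map] at hy
    obtain ⟨i, hi, rfl⟩ := hy
    exact annihilate_mul_annihilate _ _)
  rw [List.length_map] at h2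
  rw [mono, mono, List.map_cons, List.prod_cons, h2, mul_smul_comm, smul_smul,
    neg_one_pow_mul_self, one_smul, mul_assoc]

lemma mono_mul_create {j : ℤ} (φ : List ℤ) {ψ : List ℤ} (hψ : j ∉ ψ) :
    mono φ ψ * create j = (-1 : ℂ) ^ ψ.length • mono (j :: φ) ψ := by
  have h2 := list_prod_mul_of_anticomm (create j) (ψ.map annihilate) (by
    intro y hy
    simp only [List.mem_map] at hy
    obtain ⟨i, hi, rfl⟩ := hy
    rw [annihilate_mul_create, if_neg (by rintro rfl; exact hψ hi), zero_sub, neg_neg])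
  rw [List.length_map] at h2
  rw [mono, mono, List.map_cons, List.reverse_cons, List.prod_append, List.prod_singleton,
    mul_assoc _ (create j), h2, mul_smul_comm, smul_smul, neg_one_pow_mul_self, one_smul, mul_assoc]

lemma mono_mul_number {j : ℤ} (φ : List ℤ) {ψ : List ℤ} (hψ : j ∉ ψ) :
    mono φ ψ * number j = mono (j :: φ) (j :: ψ) := by
  rw [number, ← mul_assoc, mono_mul_create φ hψ, smul_mul_assoc, mono_mul_annihilate, smul_smul,
    neg_one_pow_mul_self, one_smul]

section QuasiFree
variable {σ : ℂ} {ω : (Fock ℤ →L[ℂ] Fock ℤ) →ₗ[ℂ] ℂ}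

lemma exists_eq_ofFn {α : Type*} (l : List α) {n : ℕ} (h : l.length = n) :
    ∃ f : Fin n → α, l = List.ofFn f := by
  subst h
  exact ⟨l.get, (List.ofFn_get l).symm⟩

lemma inner_Psi (i j : ℤ) : ⟪Psi i, Psi j⟫_ℂ = if i = j then 1 else 0 := by
  rw [Psi, lp.inner_single_left, Psi, lp.single_apply]
  by_cases h : i = j
  · subst h; simp
  · simp [h]

lemma IsQuasiFree.apply_of_ne (h : IsQuasiFree (σ • (1 : ReservoirSpace →L[ℂ] ReservoirSpace)) ω)
    {φ ψ : List ℤ} (hne : φ.length ≠ ψ.length) : ω (mono φ ψ) = 0 := by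
  obtain ⟨f, hf⟩ := exists_eq_ofFn φ rfl
  obtain ⟨g, hg⟩ := exists_eq_ofFn ψ rfl
  have := h.1 _ _ f g hne
  rw [hf, hg, mono, List.map_ofFn, List.map_ofFn]
  exact this

lemma IsQuasiFree.apply_ofFn
    (h : IsQuasiFree (σ • (1 : ReservoirSpace →L[ℂ] ReservoirSpace)) ω) {n : ℕ} (f g : Fin n → ℤ) :
    ω (mono (List.ofFn f) (List.ofFn g)) =
      (Matrix.of fun j k => if g j = f k then σ else 0).det := by
  rw [mono, List.map_ofFn, List.map_ofFn]
  refine (h.2 n f g).trans ?_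
  congr 2
  funext j k
  change ⟪_, σ • Psi (f k)⟫_ℂ = _
  rw [inner_smul_right, inner_Psi, mul_ite, mul_one, mul_zero]

lemma IsQuasiFree.apply_cons_right
    (h : IsQuasiFree (σ • (1 : ReservoirSpace →L[ℂ] ReservoirSpace)) ω) {j : ℤ} {φ : List ℤ}
    (hφ : j ∉ φ) (ψ : List ℤ) : ω (mono φ (j :: ψ)) = 0 := by
  by_cases hl : φ.length = (j :: ψ).length
  · obtain ⟨g, hg⟩ := exists_eq_ofFn ψ rfl
    obtain ⟨f, hf⟩ := exists_eq_ofFn φ hl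
    rw [hf, List.mem_ofFn] at hφ
    have hg' : j :: ψ = List.ofFn (Fin.cons j g) := by rw [List.ofFn_cons, ← hg]
    rw [hg', hf]
    refine (h.apply_ofFn f (Fin.cons j g : Fin (ψ.length + 1) → ℤ)).trans
      (Matrix.det_eq_zero_of_row_eq_zero 0 fun k => ?_)
    simp only [Matrix.of_apply, Fin.cons_zero]
    exact if_neg fun he => hφ ⟨k, he.symm⟩
  · exact h.apply_of_ne hl

lemma IsQuasiFree.apply_cons_left
    (h : IsQuasiFree (σ • (1 : ReservoirSpace →L[ℂ] ReservoirSpace)) ω) {j : ℤ} (φ : List ℤ)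
    {ψ : List ℤ} (hψ : j ∉ ψ) : ω (mono (j :: φ) ψ) = 0 := by
  by_cases hl : (j :: φ).length = ψ.length
  · obtain ⟨f, hf⟩ := exists_eq_ofFn φ rfl
    obtain ⟨g, hg⟩ := exists_eq_ofFn ψ hl.symm
    rw [hg, List.mem_ofFn] at hψ
    have hf' : j :: φ = List.ofFn (Fin.cons j f) := by rw [List.ofFn_cons, ← hf]
    rw [hf', hg]
    refine (h.apply_ofFn (Fin.cons j f : Fin (φ.length + 1) → ℤ) g).trans
      (Matrix.det_eq_zero_of_column_eq_zero 0 fun k => ?_)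
    simp only [Matrix.of_apply, Fin.cons_zero]
    exact if_neg fun he => hψ ⟨k, he⟩
  · exact h.apply_of_ne hl

lemma IsQuasiFree.apply_cons_cons
    (h : IsQuasiFree (σ • (1 : ReservoirSpace →L[ℂ] ReservoirSpace)) ω) {j : ℤ} {φ : List ℤ}
    (hφ : j ∉ φ) (ψ : List ℤ) : ω (mono (j :: φ) (j :: ψ)) = σ * ω (mono φ ψ) := by
  by_cases hl : φ.length = ψ.length
  · obtain ⟨g, hg⟩ := exists_eq_ofFn ψ rfl
    obtain ⟨f, hf⟩ := exists_eq_ofFn φ hl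
    rw [hf, List.mem_ofFn] at hφ
    have hg' : j :: ψ = List.ofFn (Fin.cons j g) := by rw [List.ofFn_cons, ← hg]
    have hf' : j :: φ = List.ofFn (Fin.cons j f) := by rw [List.ofFn_cons, ← hf]
    rw [hg', hf']
    refine (h.apply_ofFn (Fin.cons j f : Fin (ψ.length + 1) → ℤ) (Fin.cons j g)).trans ?_
    rw [Matrix.det_succ_row_zero, Fin.sum_univ_succ, Finset.sum_eq_zero, add_zero]
    · have hfg := h.apply_ofFn f g
      rw [← hf, ← hg] at hfg
      rw [hfg]
      simp only [Matrix.of_apply, Fin.cons_zero, if_true, Fin.val_zero, pow_zero, one_mul]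
      congr 2
    · intro k _
      have : ¬ j = f k := fun he => hφ ⟨k, he.symm⟩
      simp [this]
  · rw [h.apply_of_ne hl, h.apply_of_ne (by simpa using hl), mul_zero]

lemma IsQuasiFree.apply_map
    (h : IsQuasiFree (σ • (1 : ReservoirSpace →L[ℂ] ReservoirSpace)) ω) {τ : ℤ → ℤ}
    (hτ : Function.Injective τ) (φ ψ : List ℤ) :
    ω (mono (φ.map τ) (ψ.map τ)) = ω (mono φ ψ) := by
  by_cases hl : φ.length = ψ.length
  · obtain ⟨g, hg⟩ := exists_eq_ofFn ψ rfl
    obtain ⟨f, hf⟩ := exists_eq_ofFn φ hl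
    rw [hg, hf, List.map_ofFn, List.map_ofFn, h.apply_ofFn, h.apply_ofFn]
    simp [hτ.eq_iff]
  · rw [h.apply_of_ne hl, h.apply_of_ne (by simpa using hl)]

end QuasiFree

/-! ## Reduction to the sample -/

section Reduction
variable {d : ℕ}

/-- The span of the `W ⊗ A`, where `W` is a monomial in the modes `j ≥ 0` of the reservoir. -/
def futureSpan (d : ℕ) : Submodule ℂ (System d →L[ℂ] System d) :=
  Submodule.span ℂ {X | ∃ (φ ψ : List ℤ) (A : Fock (Fin d) →L[ℂ] Fock (Fin d)),
    (∀ j ∈ φ, 0 ≤ j) ∧ (∀ j ∈ ψ, 0 ≤ j) ∧ X = tens (mono φ ψ) A}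

lemma tens_mem_futureSpan {φ ψ : List ℤ} (hφ : ∀ j ∈ φ, 0 ≤ j) (hψ : ∀ j ∈ ψ, 0 ≤ j)
    (A : Fock (Fin d) →L[ℂ] Fock (Fin d)) : tens (mono φ ψ) A ∈ futureSpan d :=
  Submodule.subset_span ⟨φ, ψ, A, hφ, hψ, rfl⟩

variable [NeZero d]

/-- The effect on the observables of the sample of one interaction with a fresh reservoir mode. -/
def sampleKick (σ c q : ℂ) :
    (Fock (Fin d) →L[ℂ] Fock (Fin d)) →ₗ[ℂ] (Fock (Fin d) →L[ℂ] Fock (Fin d)) where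
  toFun A := (1 - σ) • (damp 0 c * A * damp 0 c) +
    σ • ((c • 1 + (1 - c) • number 0) * A * (c • 1 + (1 - c) • number 0)) +
    q • (σ • (annihilate 0 * A * create 0) + (1 - σ) • (create 0 * A * annihilate 0))
  map_add' A B := by
    simp only [mul_add, add_mul (_ * A)]
    module
  map_smul' r A := by
    simp only [mul_smul_comm, smul_mul_assoc (_ : ℂ) (_ * A), RingHom.id_apply]
    module

lemma coupling_conj_tens {σ : ℂ} {ω : (Fock ℤ →L[ℂ] Fock ℤ) →ₗ[ℂ] ℂ}
    (h : IsQuasiFree (σ • (1 : ReservoirSpace →L[ℂ] ReservoirSpace)) ω) (α : ℝ)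
    {φ ψ : List ℤ} (hφ : ∀ j ∈ φ, 0 < j) (hψ : ∀ j ∈ ψ, 0 < j)
    (A : Fock (Fin d) →L[ℂ] Fock (Fin d)) :
    star (coupling d α) * tens (mono φ ψ) A * coupling d α ∈ futureSpan d ∧
    partialExp ω (star (coupling d α) * tens (mono φ ψ) A * coupling d α) =
      ω (mono φ ψ) • sampleKick σ (Real.cos α) ((Real.sin α) ^ 2) A := by
  have hφ0 : (0 : ℤ) ∉ φ := fun h0 => lt_irrefl _ (hφ 0 h0)
  have hψ0 : (0 : ℤ) ∉ ψ := fun h0 => lt_irrefl _ (hψ 0 h0)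
  have hφ' : ∀ j ∈ φ, 0 ≤ j := fun j hj => (hφ j hj).le
  have hψ' : ∀ j ∈ ψ, 0 ≤ j := fun j hj => (hψ j hj).le
  have hφ1 : ∀ j ∈ (0 :: φ), 0 ≤ j := by simpa using hφ'
  have hψ1 : ∀ j ∈ (0 :: ψ), 0 ≤ j := by simpa using hψ'
  set ε : ℂ := (-1) ^ (φ.length + ψ.length) with hε
  set c : ℂ := ((Real.cos α : ℝ) : ℂ)
  set s : ℂ := ((Real.sin α : ℝ) : ℂ)
  obtain ⟨C₂, C₃, hC⟩ := kick_mul_tens_mul_kick (d := d) c (ε * (Complex.I * s))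
    (-(Complex.I * s)) A
  have hK : star (coupling d α) = kick d c (Complex.I * s) := by
    rw [coupling_eq_kick, star_kick]
    simp [c, s, -Complex.ofReal_cos, -Complex.ofReal_sin]
  have hX : star (coupling d α) * tens (mono φ ψ) A * coupling d α = tens (mono φ ψ) 1 *
      (kick d c (ε * (Complex.I * s)) * tens 1 A * kick d c (-(Complex.I * s))) := by
    rw [hK, coupling_eq_kick, show tens (mono φ ψ) A = tens (mono φ ψ) 1 * tens 1 A by
      rw [tens_mul, mul_one, one_mul], ← mul_assoc (kick d c _),
      kick_mul_tens_of_anticomm c _ ε (neg_one_pow_mul_self _) (mono φ ψ)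
        (annihilate_mul_mono hφ0 ψ) (create_mul_mono φ hψ0)]
    simp only [mul_assoc]
    rfl
  rw [hX, hC]
  have hexp : ∀ T X₀ X₁ X₂ X₃ : System d →L[ℂ] System d,
      T * (X₀ + X₁ + X₂ + X₃) = T * X₀ + T * X₁ + T * X₂ + T * X₃ := by
    intro T X₀ X₁ X₂ X₃
    simp only [mul_add]
  rw [hexp]
  simp only [tens_mul, one_mul, mul_one, mono_mul_number φ hψ0, mono_mul_annihilate,
    mono_mul_create φ hψ0, tens_smul_left]
  refine ⟨add_mem (add_mem (add_mem (tens_mem_futureSpan hφ' hψ' _)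
    (tens_mem_futureSpan hφ1 hψ1 _)) (Submodule.smul_mem _ _ (tens_mem_futureSpan hφ' hψ1 _)))
    (Submodule.smul_mem _ _ (tens_mem_futureSpan hφ1 hψ' _)), ?_⟩
  rw [map_add, map_add, map_add, map_smul, map_smul, partialExp_tens, partialExp_tens,
    partialExp_tens, partialExp_tens, h.apply_cons_cons hφ0, h.apply_cons_right hφ0,
    h.apply_cons_left φ hψ0, zero_smul, zero_smul, smul_zero, add_zero, add_zero]
  by_cases hl : φ.length = ψ.length
  · have hε1 : ε = 1 := by rw [hε, hl]; exact Even.neg_one_pow ⟨_, rfl⟩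
    have hz : ε * (Complex.I * s) * -(Complex.I * s) = s ^ 2 := by
      rw [hε1]
      linear_combination (-s ^ 2) * Complex.I_sq
    have hk : damp (0 : Fin d) c + (c - 1) • (1 - (2 : ℂ) • number 0) =
        c • 1 + (1 - c) • number 0 := by
      rw [damp]; module
    rw [hz, hk]
    simp only [sampleKick, LinearMap.coe_mk, AddHom.coe_mk]
    module
  · simp [h.apply_of_ne hl]

lemma star_mul_list_prod_mul {R : Type*} [Ring R] [StarRing R] {u : R} (h1 : star u * u = 1)
    (h2 : u * star u = 1) (l : List R) :
    star u * l.prod * u = (l.map fun y => star u * y * u).prod := by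
  induction l with
  | nil => simp [h1]
  | cons y l ih =>
    rw [List.prod_cons, List.map_cons, List.prod_cons, ← ih]
    simp only [mul_assoc]
    rw [← mul_assoc u (star u), h2, one_mul]

lemma star_secondQuant_mono (τ : Equiv.Perm ℤ) (φ ψ : List ℤ) :
    star (secondQuant τ) * mono φ ψ * secondQuant τ = mono (φ.map τ.symm) (ψ.map τ.symm) := by
  have h1 := star_secondQuant_mul_self τ
  have h2 := secondQuant_mul_star_self τ
  rw [mono, ← List.prod_append, star_mul_list_prod_mul h1 h2, List.map_append, List.prod_append,
    mono]
  congr 2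
  · simp [Function.comp_def, star_secondQuant_create]
  · simp [Function.comp_def, star_secondQuant_annihilate]

/-- The free evolution of the observables of the sample. -/
def rotate : (Fock (Fin d) →L[ℂ] Fock (Fin d)) →ₗ[ℂ] (Fock (Fin d) →L[ℂ] Fock (Fin d)) :=
  LinearMap.mulLeft ℂ (star (secondQuant (shiftPerm (Fin d)))) ∘ₗ
    LinearMap.mulRight ℂ (secondQuant (shiftPerm (Fin d)))

lemma rotate_apply (A : Fock (Fin d) →L[ℂ] Fock (Fin d)) :
    rotate A = star (secondQuant (shiftPerm (Fin d))) * A * secondQuant (shiftPerm (Fin d)) := by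
  rw [mul_assoc]; rfl

/-- One step of the reduced evolution of the observables of the sample. -/
def channel (σ c q : ℂ) :
    (Fock (Fin d) →L[ℂ] Fock (Fin d)) →ₗ[ℂ] (Fock (Fin d) →L[ℂ] Fock (Fin d)) :=
  sampleKick σ c q ∘ₗ rotate

lemma step_conj {σ : ℂ} {ω : (Fock ℤ →L[ℂ] Fock ℤ) →ₗ[ℂ] ℂ}
    (h : IsQuasiFree (σ • (1 : ReservoirSpace →L[ℂ] ReservoirSpace)) ω) (α : ℝ)
    {X : System d →L[ℂ] System d} (hX : X ∈ futureSpan d) :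
    star (step d α) * X * step d α ∈ futureSpan d ∧
    partialExp ω (star (step d α) * X * step d α) =
      channel σ (Real.cos α) ((Real.sin α) ^ 2) (partialExp ω X) := by
  induction hX using Submodule.span_induction with
  | mem X hX =>
    obtain ⟨φ, ψ, A, hφ, hψ, rfl⟩ := hX
    have hF : star (step d α) * tens (mono φ ψ) A * step d α = star (coupling d α) *
        tens (mono (φ.map (shiftPerm ℤ).symm) (ψ.map (shiftPerm ℤ).symm)) (rotate A) *
          coupling d α := by
      have hU : freeStep d = tens (secondQuant (shiftPerm ℤ)) (secondQuant (shiftPerm (Fin d))) :=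
        rfl
      rw [← star_secondQuant_mono, rotate_apply, ← tens_mul, ← tens_mul, ← star_tens, ← hU, step,
        star_mul]
      simp only [mul_assoc]
    have hpos : ∀ l : List ℤ, (∀ j ∈ l, 0 ≤ j) → ∀ j ∈ l.map (shiftPerm ℤ).symm, 0 < j := by
      intro l hl j hj
      obtain ⟨i, hi, rfl⟩ := List.mem_map.1 hj
      have := hl i hi
      simp only [shiftPerm, Equiv.subRight_symm_apply]
      omega
    rw [hF, partialExp_tens, map_smul, ← h.apply_map (shiftPerm ℤ).symm.injective]
    exact coupling_conj_tens h α (hpos φ hφ) (hpos ψ hψ) (rotate A)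
  | zero => simp
  | add X Y _ _ hX hY =>
    rw [mul_add, add_mul, map_add, map_add, map_add, hX.2, hY.2]
    exact ⟨add_mem hX.1 hY.1, rfl⟩
  | smul r X _ hX =>
    rw [mul_smul_comm, smul_mul_assoc, map_smul, map_smul, map_smul, hX.2]
    exact ⟨Submodule.smul_mem _ _ hX.1, rfl⟩

lemma sampleState_eq {σ : ℂ} {ω : (Fock ℤ →L[ℂ] Fock ℤ) →ₗ[ℂ] ℂ}
    (h : IsQuasiFree (σ • (1 : ReservoirSpace →L[ℂ] ReservoirSpace)) ω) (hω : ω 1 = 1) (α : ℝ)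
    (ρ : Fock (Fin d) →L[ℂ] Fock (Fin d)) (t : ℕ) :
    sampleState α ω ρ t = fun A =>
      expectationₗ ρ ((channel σ (Real.cos α) ((Real.sin α) ^ 2))^[t] A) := by
  funext A
  have key : evolve d α t (onSample A) ∈ futureSpan d ∧
      partialExp ω (evolve d α t (onSample A)) =
        (channel σ (Real.cos α) ((Real.sin α) ^ 2))^[t] A := by
    induction t with
    | zero =>
      have h0 : evolve d α 0 (onSample A) = tens (mono [] []) A := by
        simp [evolve, mono, tens_one_left]
      rw [h0, partialExp_tens]
      exact ⟨tens_mem_futureSpan (by simp) (by simp) A, by simp [mono, hω]⟩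
    | succ t ih =>
      have h1 : evolve d α (t + 1) (onSample A) =
          star (step d α) * evolve d α t (onSample A) * step d α := by
        rw [evolve, evolve, pow_succ', pow_succ, ← ContinuousLinearMap.star_eq_adjoint]
        simp only [mul_assoc]
      rw [h1, Function.iterate_succ_apply', ← ih.2]
      exact step_conj h α ih.1
  rw [sampleState, productState_eq_expectation, key.2]
  rfl

end Reduction

/-! ## Sums over the subsets of a finite set -/

section Mix
variable {κ M : Type*} [DecidableEq κ] [AddCommGroup M] [Module ℂ M]

/-- `∑_{T ⊆ s} ∏_{i ∈ T} u_i ∏_{i ∈ s ∖ T} v_i f(T)`. -/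
def mix (u v : κ → ℂ) (f : Finset κ → M) (s : Finset κ) : M :=
  ∑ T ∈ s.powerset, ((∏ i ∈ T, u i) * ∏ i ∈ s \ T, v i) • f T

lemma mix_insert (u v : κ → ℂ) (f : Finset κ → M) {i : κ} {s : Finset κ} (hi : i ∉ s) :
    mix u v f (insert i s) = u i • mix u v (fun T => f (insert i T)) s + v i • mix u v f s := by
  rw [mix, Finset.sum_powerset_insert hi, add_comm, mix, mix, Finset.smul_sum, Finset.smul_sum]
  congr 1
  · refine Finset.sum_congr rfl fun T hT => ?_
    have hiT : i ∉ T := fun h => hi (Finset.mem_powerset.1 hT h)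
    rw [Finset.prod_insert hiT, Finset.insert_sdiff_insert, Finset.sdiff_insert_of_notMem hi,
      smul_smul, mul_assoc]
  · refine Finset.sum_congr rfl fun T hT => ?_
    have hiT : i ∉ T := fun h => hi (Finset.mem_powerset.1 hT h)
    rw [Finset.insert_sdiff_of_notMem _ hiT, Finset.prod_insert (by simp [hi]), smul_smul]
    congr 1
    ring

lemma mix_congr {u v u' v' : κ → ℂ} {f g : Finset κ → M} {s : Finset κ}
    (hu : ∀ i ∈ s, u i = u' i) (hv : ∀ i ∈ s, v i = v' i) (h : ∀ T ⊆ s, f T = g T) :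
    mix u v f s = mix u' v' g s := by
  refine Finset.sum_congr rfl fun T hT => ?_
  rw [Finset.mem_powerset] at hT
  rw [h T hT, Finset.prod_congr rfl fun i hi => hu i (hT hi),
    Finset.prod_congr rfl fun i hi => hv i (Finset.mem_sdiff.1 hi).1]

lemma mix_eq_self {u v : κ → ℂ} {s : Finset κ} (hu : ∀ i ∈ s, u i = 1) (hv : ∀ i ∈ s, v i = 0)
    (f : Finset κ → M) : mix u v f s = f s := by
  induction s using Finset.induction_on generalizing f with
  | empty => simp [mix]
  | insert i s hi ih =>
    simp only [Finset.mem_insert, forall_eq_or_imp] at hu hv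
    rw [mix_insert u v f hi, ih hu.2 hv.2, hu.1, hv.1, one_smul, zero_smul, add_zero]

lemma mix_add (u v : κ → ℂ) (f g : Finset κ → M) (s : Finset κ) :
    mix u v (fun T => f T + g T) s = mix u v f s + mix u v g s := by
  simp only [mix, smul_add, Finset.sum_add_distrib]

lemma mix_smul (u v : κ → ℂ) (r : ℂ) (f : Finset κ → M) (s : Finset κ) :
    mix u v (fun T => r • f T) s = r • mix u v f s := by
  simp only [mix, Finset.smul_sum, smul_comm r]

lemma mix_mix (u v u' v' : κ → ℂ) (f : Finset κ → M) (s : Finset κ) :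
    mix u v (mix u' v' f) s = mix (fun i => u i * u' i) (fun i => v i + u i * v' i) f s := by
  induction s using Finset.induction_on generalizing f with
  | empty => simp [mix]
  | insert i s hi ih =>
    have h : ∀ T ⊆ s, mix u' v' f (insert i T) =
        u' i • mix u' v' (fun T => f (insert i T)) T + v' i • mix u' v' f T :=
      fun T hT => mix_insert u' v' f fun h => hi (hT h)
    rw [mix_insert _ _ _ hi, mix_insert _ _ _ hi, mix_congr (fun _ _ => rfl) (fun _ _ => rfl) h,
      mix_add, mix_smul, mix_smul, ih, ih]
    module

lemma map_mix {N : Type*} [AddCommGroup N] [Module ℂ N] (L : M →ₗ[ℂ] N) (u v : κ → ℂ)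
    (f : Finset κ → M) (s : Finset κ) : L (mix u v f s) = mix u v (fun T => L (f T)) s := by
  simp only [mix, map_sum, map_smul]

end Mix

/-! ## Products `a^*_{y 1} ⋯ a^*_{y k} a_{x k} ⋯ a_{x 1}` -/

section Words
variable {ι κ : Type}

/-- `a^*_{y i₁} ⋯ a^*_{y i_k} a_{x i_k} ⋯ a_{x i₁}` for the list `i₁, …, i_k`. -/
def word (x y : κ → ι) (l : List κ) : Fock ι →L[ℂ] Fock ι :=
  (l.map fun i => create (y i)).prod * star (l.map fun i => create (x i)).prod

lemma word_nil (x y : κ → ι) : word x y [] = 1 := by simp [word]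

lemma word_cons (x y : κ → ι) (i : κ) (l : List κ) :
    word x y (i :: l) = create (y i) * word x y l * annihilate (x i) := by
  simp only [word, List.map_cons, List.prod_cons, star_mul, star_create, mul_assoc]

lemma word_perm (x y : κ → ι) {l l' : List κ} (h : l.Perm l') : word x y l = word x y l' := by
  induction h with
  | nil => rfl
  | cons i _ ih => rw [word_cons, word_cons, ih]
  | swap i j l =>
    simp only [word_cons, mul_assoc]
    rw [annihilate_mul_annihilate (x i) (x j), ← mul_assoc (create (y j)),
      create_mul_create (y j) (y i)]
    simp only [mul_neg, neg_mul, neg_neg, mul_assoc]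
  | trans _ _ h1 h2 => rw [h1, h2]

lemma word_map {κ' : Type} (x y : κ → ι) (f : κ' → κ) (l : List κ') :
    word x y (l.map f) = word (x ∘ f) (y ∘ f) l := by
  simp [word, Function.comp_def]

/-- The operator `word` for the elements of a finite set, in an arbitrary order. -/
def finWord (x y : κ → ι) (s : Finset κ) : Fock ι →L[ℂ] Fock ι := word x y s.toList

variable [DecidableEq κ]

lemma finWord_insert (x y : κ → ι) {i : κ} {s : Finset κ} (hi : i ∉ s) :
    finWord x y (insert i s) = create (y i) * finWord x y s * annihilate (x i) := by
  rw [finWord, word_perm x y (Finset.toList_insert hi), word_cons, finWord]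

lemma commute_finWord {B : Fock ι →L[ℂ] Fock ι} {x y : κ → ι} {s : Finset κ}
    (hx : ∀ i ∈ s, B * annihilate (x i) = -(annihilate (x i) * B))
    (hy : ∀ i ∈ s, B * create (y i) = -(create (y i) * B)) :
    B * finWord x y s = finWord x y s * B := by
  induction s using Finset.induction_on with
  | empty => simp [finWord, word_nil]
  | insert i s hi ih =>
    simp only [Finset.mem_insert, forall_eq_or_imp] at hx hy
    rw [finWord_insert x y hi, ← mul_assoc, ← mul_assoc, hy.1, neg_mul, mul_assoc (create _) B,
      ih hx.2 hy.2, neg_mul, mul_assoc, mul_assoc, mul_assoc, hx.1]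
    simp only [mul_neg, neg_neg, mul_assoc]

end Words

/-! ## The reduced evolution of the sample -/

section Sample
variable {d : ℕ} [NeZero d]

lemma annihilate_create_of_ne {ι : Type} {i j : ι} (h : i ≠ j) :
    annihilate i * create j = -(create j * annihilate i) := by
  classical
  rw [annihilate_mul_create, if_neg h, zero_sub]

lemma create_annihilate_of_ne {ι : Type} {i j : ι} (h : i ≠ j) :
    create i * annihilate j = -(annihilate j * create i) := by
  rw [annihilate_create_of_ne h.symm, neg_neg]

lemma sampleKick_of_eigen (σ c q : ℂ) {X : Fock (Fin d) →L[ℂ] Fock (Fin d)} {r s : ℂ}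
    (hr : number 0 * X = r • X) (hs : X * number 0 = s • X) :
    sampleKick σ c q X = ((1 - σ) * (1 + (c - 1) * r) * (1 + (c - 1) * s) +
      σ * (c + (1 - c) * r) * (c + (1 - c) * s)) • X +
      q • (σ • (annihilate 0 * X * create 0) + (1 - σ) • (create 0 * X * annihilate 0)) := by
  simp only [sampleKick, LinearMap.coe_mk, AddHom.coe_mk, damp, add_mul, mul_add, one_mul, mul_one,
    smul_mul_assoc, mul_smul_comm, hr, hs]
  module

variable {B : Fock (Fin d) →L[ℂ] Fock (Fin d)}

lemma sampleKick_occupied (σ c : ℂ) (ha : annihilate 0 * B = B * annihilate 0)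
    (hc : create 0 * B = B * create 0) :
    sampleKick σ c (1 - c ^ 2) (create 0 * B * annihilate 0) =
      (c * c) • (create 0 * B * annihilate 0) + ((1 - c ^ 2) * σ) • B := by
  have h0 : create 0 * B * annihilate 0 = B * number 0 := by rw [hc, mul_assoc]; rfl
  have hn : number 0 * B = B * number 0 := by
    rw [number, mul_assoc, ha, ← mul_assoc, hc, mul_assoc]
  have h1 : number 0 * (B * number 0) = (1 : ℂ) • (B * number 0) := by
    rw [← mul_assoc, hn, mul_assoc, number_mul_self, one_smul]
  have h2 : B * number 0 * number 0 = (1 : ℂ) • (B * number 0) := by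
    rw [mul_assoc, number_mul_self, one_smul]
  have h3 : annihilate 0 * (B * number 0) * create 0 = B - B * number 0 := by
    rw [← mul_assoc, ha, mul_assoc, mul_assoc, number_mul_create, annihilate_mul_create_self,
      mul_sub, mul_one]
  have h4 : create 0 * (B * number 0) * annihilate 0 = 0 := by
    rw [← mul_assoc, mul_assoc, number_mul_annihilate, mul_zero]
  rw [h0, sampleKick_of_eigen σ c _ h1 h2, h3, h4]
  module

lemma sampleKick_of_commute (σ c : ℂ) (ha : annihilate 0 * B = B * annihilate 0)
    (hc : create 0 * B = B * create 0) : sampleKick σ c (1 - c ^ 2) B = B := by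
  have h0 : create 0 * B * annihilate 0 = B * number 0 := by rw [hc, mul_assoc]; rfl
  have hn : number 0 * B = B * number 0 := by
    rw [number, mul_assoc, ha, ← mul_assoc, hc, mul_assoc]
  have h1 : number 0 * (B - B * number 0) = (0 : ℂ) • (B - B * number 0) := by
    rw [mul_sub, ← mul_assoc, hn, mul_assoc, number_mul_self, sub_self, zero_smul]
  have h2 : (B - B * number 0) * number 0 = (0 : ℂ) • (B - B * number 0) := by
    rw [sub_mul, mul_assoc, number_mul_self, sub_self, zero_smul]
  have h3 : annihilate 0 * (B - B * number 0) = 0 := by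
    rw [mul_sub, ← mul_assoc, ha, mul_assoc, annihilate_mul_number, sub_self]
  have h4 : create 0 * (B - B * number 0) * annihilate 0 = B * number 0 := by
    rw [mul_sub, sub_mul, h0, ← mul_assoc, mul_assoc, number_mul_annihilate, mul_zero, sub_zero]
  have h := sampleKick_occupied σ c ha hc
  rw [h0] at h
  rw [← sub_add_cancel B (B * number 0), map_add, h, sampleKick_of_eigen σ c _ h1 h2, h3, h4,
    zero_mul]
  module

lemma sampleKick_annihilate (σ c q : ℂ) (ha : annihilate 0 * B = B * annihilate 0)
    {j : Fin d} (hj : j ≠ 0) :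
    sampleKick σ c q (create j * B * annihilate 0) = c • (create j * B * annihilate 0) := by
  have h3 : annihilate 0 * (create j * B * annihilate 0) = 0 := by
    rw [← mul_assoc, ← mul_assoc, annihilate_create_of_ne hj.symm, neg_mul, mul_assoc _ _ B, ha,
      neg_mul, mul_assoc, mul_assoc B, annihilate_mul_self, mul_zero, mul_zero, neg_zero]
  have h1 : number 0 * (create j * B * annihilate 0) = (0 : ℂ) • (create j * B * annihilate 0) := by
    rw [number, mul_assoc, h3, mul_zero, zero_smul]
  have h2 : create j * B * annihilate 0 * number 0 = (1 : ℂ) • (create j * B * annihilate 0) := by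
    rw [mul_assoc, annihilate_mul_number, one_smul]
  have h4 : create 0 * (create j * B * annihilate 0) * annihilate 0 = 0 := by
    rw [mul_assoc, mul_assoc _ (annihilate 0), annihilate_mul_self, mul_zero, mul_zero]
  rw [sampleKick_of_eigen σ c q h1 h2, h3, h4, zero_mul]
  module

lemma sampleKick_create (σ c q : ℂ) (hc : create 0 * B = B * create 0)
    {j : Fin d} (hj : j ≠ 0) :
    sampleKick σ c q (create 0 * B * annihilate j) = c • (create 0 * B * annihilate j) := by
  have h3 : create 0 * B * annihilate j * create 0 = 0 := by
    rw [mul_assoc, annihilate_create_of_ne hj, hc, mul_assoc, mul_neg, ← mul_assoc (create 0),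
      create_mul_self, zero_mul, neg_zero, mul_zero]
  have h1 : number 0 * (create 0 * B * annihilate j) = (1 : ℂ) • (create 0 * B * annihilate j) := by
    rw [← mul_assoc, ← mul_assoc, number_mul_create, one_smul]
  have h2 : create 0 * B * annihilate j * number 0 = (0 : ℂ) • (create 0 * B * annihilate j) := by
    rw [number, ← mul_assoc, h3, zero_mul, zero_smul]
  have h4 : create 0 * (create 0 * B * annihilate j) = 0 := by
    rw [← mul_assoc, ← mul_assoc, create_mul_self, zero_mul, zero_mul]
  rw [sampleKick_of_eigen σ c q h1 h2, mul_assoc (annihilate 0), h3, h4]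
  simp only [mul_zero, zero_mul]
  module

variable {κ : Type} [DecidableEq κ]

/-- Two families of labels which have values in common at the same places only. -/
structure Aligned {ι : Type} (x y : κ → ι) : Prop where
  left : Function.Injective x
  right : Function.Injective y
  eq_of_eq : ∀ i j, x i = y j → i = j

lemma sampleKick_finWord (σ c : ℂ) {x y : κ → Fin d} (h : Aligned x y) (s : Finset κ) :
    sampleKick σ c (1 - c ^ 2) (finWord x y s) =
      mix (fun i => (if x i = 0 then c else 1) * (if y i = 0 then c else 1))
        (fun i => if x i = 0 ∧ y i = 0 then (1 - c ^ 2) * σ else 0) (finWord x y) s := by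
  have hcomm : ∀ T : Finset κ, (∀ i ∈ T, x i ≠ 0 ∧ y i ≠ 0) →
      annihilate 0 * finWord x y T = finWord x y T * annihilate 0 ∧
        create 0 * finWord x y T = finWord x y T * create 0 := fun T hT =>
    ⟨commute_finWord (fun i _ => annihilate_mul_annihilate _ _)
      (fun i hi => annihilate_create_of_ne (hT i hi).2.symm),
    commute_finWord (fun i hi => create_annihilate_of_ne (hT i hi).1.symm)
      (fun i _ => create_mul_create _ _)⟩
  by_cases hs : ∀ i ∈ s, x i ≠ 0 ∧ y i ≠ 0
  · rw [mix_eq_self (fun i hi => by simp [hs i hi]) (fun i hi => by simp [hs i hi]),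
      sampleKick_of_commute σ c (hcomm s hs).1 (hcomm s hs).2]
  · push Not at hs
    obtain ⟨i, hi, hi0⟩ := hs
    obtain ⟨T, hiT, rfl⟩ : ∃ T, i ∉ T ∧ insert i T = s :=
      ⟨s.erase i, Finset.notMem_erase i s, Finset.insert_erase hi⟩
    have hT : ∀ k ∈ T, x k ≠ 0 ∧ y k ≠ 0 := by
      intro k hk
      have hki : k ≠ i := fun he => hiT (he ▸ hk)
      by_cases hx : x i = 0
      · exact ⟨fun h0 => hki (h.left (h0.trans hx.symm)),
          fun h0 => hki (h.eq_of_eq i k (hx.trans h0.symm)).symm⟩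
      · have hy := hi0 hx
        exact ⟨fun h0 => hki (h.eq_of_eq k i (h0.trans hy.symm)),
          fun h0 => hki (h.right (h0.trans hy.symm))⟩
    rw [mix_insert _ _ _ hiT, mix_eq_self (fun k hk => by simp [hT k hk])
      (fun k hk => by simp [hT k hk]), mix_eq_self (fun k hk => by simp [hT k hk])
      (fun k hk => by simp [hT k hk]), finWord_insert x y hiT]
    obtain ⟨ha, hc⟩ := hcomm T hT
    by_cases hx : x i = 0
    · by_cases hy : y i = 0
      · simp only [hx, hy, if_true, and_self]
        exact sampleKick_occupied σ c ha hc
      · simp only [hx, hy, if_true, if_false, and_false, zero_smul, add_zero, mul_one]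
        exact sampleKick_annihilate σ c _ ha hy
    · have hy := hi0 hx
      simp only [hx, hy, if_true, if_false, false_and, zero_smul, add_zero, one_mul]
      exact sampleKick_create σ c _ hc hx

lemma rotate_finWord (x y : κ → Fin d) (s : Finset κ) :
    rotate (finWord x y s) = finWord (fun i => x i + 1) (fun i => y i + 1) s := by
  have hsymm : ∀ j : Fin d, (shiftPerm (Fin d)).symm j = j + 1 := fun j => rfl
  have h1 := star_secondQuant_mul_self (shiftPerm (Fin d))
  have h2 := secondQuant_mul_star_self (shiftPerm (Fin d))
  have hmul : ∀ A C : Fock (Fin d) →L[ℂ] Fock (Fin d), rotate (A * C) = rotate A * rotate C := by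
    intro A C
    simp only [rotate_apply, mul_assoc]
    rw [← mul_assoc (secondQuant _) (star _), h2, one_mul]
  induction s using Finset.induction_on with
  | empty => simp [finWord, word_nil, rotate_apply, h1]
  | insert i s hi ih =>
    rw [finWord_insert _ _ hi, finWord_insert _ _ hi, hmul, hmul, ih, rotate_apply, rotate_apply,
      star_secondQuant_create, star_secondQuant_annihilate, hsymm, hsymm]

/-- The damping of the mode `j` of the sample during the first `t` steps. -/
def damping (c : ℂ) (t : ℕ) (j : Fin d) : ℂ :=
  ∏ τ ∈ Finset.range t, if j + (τ + 1) • (1 : Fin d) = 0 then c else 1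

lemma channel_iterate_finWord (σ c : ℂ) {x y : κ → Fin d} (h : Aligned x y) (t : ℕ)
    (s : Finset κ) :
    (channel σ c (1 - c ^ 2))^[t] (finWord x y s) =
      mix (fun i => damping c t (x i) * damping c t (y i))
        (fun i => if x i = y i then σ * (1 - damping c t (x i) * damping c t (y i)) else 0)
        (finWord (fun i => x i + t • (1 : Fin d)) (fun i => y i + t • (1 : Fin d))) s := by
  induction t with
  | zero =>
    rw [mix_eq_self (by simp [damping]) (by simp [damping])]
    simp
  | succ t ih =>
    rw [Function.iterate_succ_apply', ih, map_mix]
    have hstep : ∀ T, channel σ c (1 - c ^ 2)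
        (finWord (fun i => x i + t • (1 : Fin d)) (fun i => y i + t • (1 : Fin d)) T) =
        mix (fun i => (if x i + (t + 1) • (1 : Fin d) = 0 then c else 1) *
            (if y i + (t + 1) • (1 : Fin d) = 0 then c else 1))
          (fun i => if x i + (t + 1) • (1 : Fin d) = 0 ∧ y i + (t + 1) • (1 : Fin d) = 0 then
            (1 - c ^ 2) * σ else 0)
          (finWord (fun i => x i + (t + 1) • (1 : Fin d)) (fun i => y i + (t + 1) • (1 : Fin d)))
          T := by
      intro T
      have h' : Aligned (fun i => x i + (t + 1) • (1 : Fin d))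
          (fun i => y i + (t + 1) • (1 : Fin d)) :=
        ⟨fun i k hik => h.left (add_right_cancel hik), fun i k hik => h.right (add_right_cancel hik),
          fun i k hik => h.eq_of_eq i k (add_right_cancel hik)⟩
      rw [channel, LinearMap.comp_apply, rotate_finWord]
      simp only [add_assoc, ← succ_nsmul]
      exact sampleKick_finWord σ c h' T
    rw [funext hstep, mix_mix]
    refine mix_congr (fun i _ => ?_) (fun i _ => ?_) fun _ _ => rfl
    · simp only [damping, Finset.prod_range_succ]
      ring
    · by_cases hxy : x i = y i
      · simp only [hxy, if_true, damping, Finset.prod_range_succ, and_self]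
        split_ifs <;> ring
      · have hn : ¬ (x i + (t + 1) • (1 : Fin d) = 0 ∧ y i + (t + 1) • (1 : Fin d) = 0) :=
          fun hz => hxy (add_right_cancel (hz.1.trans hz.2.symm))
        simp [hxy, hn]

lemma val_nsmul_one (n : ℕ) : (n • (1 : Fin d)).val = n % d := by
  induction n with
  | zero => simp
  | succ n ih => rw [succ_nsmul, Fin.val_add, ih, Fin.val_one', ← Nat.add_mod]

lemma damping_mul (c : ℂ) (m : ℕ) (j : Fin d) : damping c (m * d) j = c ^ m := by
  induction m with
  | zero => simp [damping]
  | succ m ih =>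
    rw [Nat.succ_mul, damping, Finset.prod_range_add, pow_succ]
    congr 1
    rw [← Fin.prod_univ_eq_prod_range
      (fun τ => if j + (m * d + τ + 1) • (1 : Fin d) = 0 then c else 1) d]
    have hτ : ∀ τ : Fin d, (if j + (m * d + τ.val + 1) • (1 : Fin d) = 0 then c else 1) =
        if τ = -(j + 1) then c else 1 := by
      intro τ
      refine if_congr ?_ rfl rfl
      have h1 : (m * d + τ.val + 1) • (1 : Fin d) = τ + 1 := by
        rw [succ_nsmul]
        congr 1
        apply Fin.ext
        rw [val_nsmul_one, add_comm, Nat.add_mul_mod_self_right, Nat.mod_eq_of_lt τ.isLt]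
      rw [h1, eq_neg_iff_add_eq_zero]
      rw [show j + (τ + 1) = τ + (j + 1) by abel]
    rw [Finset.prod_congr rfl fun τ _ => hτ τ, Finset.prod_ite_eq']
    simp

lemma channel_iterate_period (σ c : ℂ) {x y : κ → Fin d} (h : Aligned x y) (m : ℕ)
    (s : Finset κ) :
    (channel σ c (1 - c ^ 2))^[m * d] (finWord x y s) =
      mix (fun _ => c ^ (2 * m)) (fun i => (1 - c ^ (2 * m)) * if x i = y i then σ else 0)
        (finWord x y) s := by
  have h0 : (m * d) • (1 : Fin d) = 0 := by
    apply Fin.ext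
    rw [val_nsmul_one]
    simp
  rw [channel_iterate_finWord σ c h]
  simp only [h0, add_zero, damping_mul]
  refine mix_congr (fun i _ => by ring) (fun i _ => ?_) fun _ _ => rfl
  split_ifs <;> ring

end Sample

/-! ## Antisymmetric functions of several labels -/

section Antisymm
variable {ι : Type} {p : ℕ}

/-- Antisymmetry of a function of `p` labels. -/
def Antisymm (F : (Fin p → ι) → ℂ) : Prop :=
  ∀ (π : Equiv.Perm (Fin p)) (x : Fin p → ι), F (x ∘ π) = sgn π * F x

lemma Antisymm.eq_zero {F : (Fin p → ι) → ℂ} (hF : Antisymm F) {x : Fin p → ι}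
    (hx : ¬ Function.Injective x) : F x = 0 := by
  simp only [Function.Injective, not_forall] at hx
  obtain ⟨a, b, hab, hne⟩ := hx
  have h := hF (Equiv.swap a b) x
  have hxs : x ∘ (Equiv.swap a b) = x := by
    funext i
    simp only [Function.comp_apply, Equiv.swap_apply_def]
    split_ifs with h1 h2
    · rw [h1, hab]
    · rw [h2, hab]
    · rfl
  rw [hxs] at h
  simp only [sgn, Equiv.Perm.sign_swap hne] at h
  push_cast at h
  linear_combination h / 2

lemma Antisymm.perm_eq {F : (Fin p → ι) → ℂ} (hF : Antisymm F) (π : Equiv.Perm (Fin p))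
    (x : Fin p → ι) : F x = sgn π * F (x ∘ π) := by
  rw [hF, ← mul_assoc, sgn_mul_self, one_mul]

lemma exists_perm_aligned {x y : Fin p → ι} (hx : Function.Injective x)
    (hy : Function.Injective y) : ∃ π : Equiv.Perm (Fin p), Aligned x (y ∘ π) := by
  classical
  have hc : ∀ i, ∃ j, (∃ j', x i = y j') → x i = y j := by
    intro i
    by_cases h : ∃ j', x i = y j'
    · obtain ⟨j, hj⟩ := h
      exact ⟨j, fun _ => hj⟩
    · exact ⟨i, fun h' => absurd h' h⟩
  choose f hf using hc
  obtain ⟨g, hg⟩ := Finset.exists_equiv_extend_of_card_eq (α := Fin p) (t := Finset.univ)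
    (by simp) (s := Finset.univ.filter fun i => ∃ j', x i = y j') (f := f) (Finset.subset_univ _)
    (by
      intro i hi j hj hij
      simp only [Finset.coe_filter, Finset.mem_univ, true_and, Set.mem_ofPred_eq] at hi hj
      exact hx ((hf i hi).trans ((congrArg y hij).trans (hf j hj).symm)))
  let π : Equiv.Perm (Fin p) := g.trans (Equiv.subtypeUnivEquiv Finset.mem_univ)
  refine ⟨π, hx, hy.comp π.injective, fun i j hij => π.injective (hy ?_)⟩
  have hi : ∃ j', x i = y j' := ⟨_, hij⟩
  have h1 : π i = f i := hg i (by simpa using hi)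
  rw [h1, ← hf i hi]
  exact hij

end Antisymm

section CreationProducts
variable {d p : ℕ}

/-- The product `a^*_{y 0} ⋯ a^*_{y (p-1)}`. -/
def creations (y : Fin p → Fin d) : Fock (Fin d) →L[ℂ] Fock (Fin d) :=
  (List.ofFn fun i => create (y i)).prod

lemma creations_perm (y : Fin p → Fin d) (π : Equiv.Perm (Fin p)) :
    creations (y ∘ π) = sgn π • creations y := by
  let f : (Fin d → ℂ) →ₗ[ℂ] (Fock (Fin d) →L[ℂ] Fock (Fin d)) :=
    Fintype.linearCombination ℂ create
  have hf : ∀ m, f m * f m = 0 := by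
    intro m
    have h1 : f m * f m = ∑ i, ∑ j, (m i * m j) • (create i * create j) := by
      change (∑ i, m i • create i) * (∑ j, m j • create j) = _
      rw [Finset.sum_mul_sum]
      refine Finset.sum_congr rfl fun i _ => Finset.sum_congr rfl fun j _ => ?_
      rw [smul_mul_smul_comm]
    have h2 : f m * f m = -(f m * f m) := by
      conv_lhs => rw [h1, Finset.sum_comm]
      rw [h1, ← Finset.sum_neg_distrib]
      refine Finset.sum_congr rfl fun i _ => ?_
      rw [← Finset.sum_neg_distrib]
      refine Finset.sum_congr rfl fun j _ => ?_
      rw [create_mul_create, smul_neg, mul_comm]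
    rwa [eq_neg_iff_add_eq_zero, ← two_smul ℂ, smul_eq_zero_iff_right two_ne_zero] at h2
  have key : ∀ z : Fin p → Fin d, creations z = ExteriorAlgebra.lift ℂ ⟨f, hf⟩
      (ExteriorAlgebra.ιMulti ℂ p ((fun j : Fin d => Pi.single j (1 : ℂ)) ∘ z)) := by
    intro z
    rw [ExteriorAlgebra.ιMulti_apply, map_list_prod, List.map_ofFn, creations]
    congr 2
    funext i
    simp only [Function.comp_apply, ExteriorAlgebra.lift_ι_apply]
    rw [Fintype.linearCombination_apply_single, one_smul]
  rw [key, key, ← Function.comp_assoc, AlternatingMap.map_perm, Units.smul_def, map_zsmul, sgn,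
    ← Int.cast_smul_eq_zsmul ℂ]

lemma word_finRange (x y : Fin p → Fin d) :
    word x y (List.finRange p) = creations y * star (creations x) := by
  rw [word, creations, creations, List.ofFn_eq_map, List.ofFn_eq_map]

lemma star_creations (x : Fin p → Fin d) :
    star (creations x) = (List.ofFn fun i => annihilate (x i)).reverse.prod := by
  have h : ∀ l : List (Fin p), star (l.map fun i => create (x i)).prod =
      (l.map fun i => annihilate (x i)).reverse.prod := by
    intro l
    induction l with
    | nil => simp
    | cons i l ih => simp [ih, star_create]
  rw [creations, List.ofFn_eq_map, List.ofFn_eq_map, h]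

variable (ν : (Fock (Fin d) →L[ℂ] Fock (Fin d)) →ₗ[ℂ] ℂ)

lemma star_sgn (π : Equiv.Perm (Fin p)) : star (sgn π) = sgn π := by simp [sgn]

lemma antisymm_word_right (x : Fin p → Fin d) :
    Antisymm fun y => ν (word x y (List.finRange p)) := by
  intro π y
  simp only [word_finRange]
  rw [creations_perm, smul_mul_assoc, map_smul, smul_eq_mul]

lemma antisymm_word_left (y : Fin p → Fin d) :
    Antisymm fun x => ν (word x y (List.finRange p)) := by
  intro π x
  simp only [word_finRange]
  rw [creations_perm, star_smul, star_sgn, mul_smul_comm, map_smul, smul_eq_mul]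

open Classical in
lemma sum_wedge_mul {F : (Fin p → Fin d) → ℂ} (hF : Antisymm F) (x : Fin p → Fin d) :
    ∑ J : Fin p → Fin d with StrictMono J, wedge J x * F J =
      ((Real.sqrt p.factorial : ℝ) : ℂ)⁻¹ * F x := by
  have h1 : ∀ J, wedge J x * F J = ((Real.sqrt p.factorial : ℝ) : ℂ)⁻¹ *
      ∑ π : Equiv.Perm (Fin p), if x = J ∘ π then F x else 0 := by
    intro J
    rw [wedge, mul_assoc, Finset.sum_mul]
    congr 1
    refine Finset.sum_congr rfl fun π _ => ?_
    split_ifs with h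
    · rw [h, hF]
    · rw [zero_mul]
  rw [Finset.sum_congr rfl fun J _ => h1 J, ← Finset.mul_sum]
  congr 1
  by_cases hx : Function.Injective x
  · set J₀ := x ∘ Tuple.sort x with hJ₀
    have hJ₀m : StrictMono J₀ := (Tuple.monotone_sort x).strictMono_of_injective
      (hx.comp (Tuple.sort x).injective)
    have hxJ : x = J₀ ∘ ⇑(Tuple.sort x)⁻¹ := by
      funext i
      simp [hJ₀]
    rw [Finset.sum_eq_single J₀, Finset.sum_eq_single (Tuple.sort x)⁻¹, if_pos hxJ]
    · intro π _ hπ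
      refine if_neg fun h => hπ ?_
      ext i
      have := hJ₀m.injective ((congrFun h i).symm.trans (congrFun hxJ i))
      rw [this]
    · simp
    · intro J hJ hne
      refine Finset.sum_eq_zero fun π _ => if_neg fun h => hne ?_
      refine (StrictMono.range_inj (Finset.mem_filter.1 hJ).2 hJ₀m).1 ?_
      rw [hJ₀, h, Function.comp_assoc, ← Equiv.Perm.coe_mul]
      exact (EquivLike.range_comp J (π * Tuple.sort (J ∘ π))).symm
    · intro h
      exact absurd (Finset.mem_filter.2 ⟨Finset.mem_univ _, hJ₀m⟩) h
  · rw [hF.eq_zero hx]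
    simp

lemma star_wedge (K y : Fin p → Fin d) : star (wedge K y) = wedge K y := by
  simp [wedge, sgn, apply_ite (starRingEnd ℂ)]

lemma reducedDensity_apply (x y : Fin p → Fin d) :
    reducedDensity ν p x y = (p.factorial : ℂ)⁻¹ * ν (word x y (List.finRange p)) := by
  classical
  have h1 : reducedDensity ν p x y = ∑ J : Fin p → Fin d with StrictMono J,
      wedge J x * ∑ K : Fin p → Fin d with StrictMono K,
        wedge K y * ν (word J K (List.finRange p)) := by
    rw [reducedDensity, Matrix.sum_apply]
    refine Finset.sum_congr rfl fun J _ => ?_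
    rw [Matrix.sum_apply, Finset.mul_sum]
    refine Finset.sum_congr rfl fun K _ => ?_
    rw [Matrix.smul_apply, Matrix.vecMulVec_apply, Pi.star_apply, star_wedge, word_finRange,
      star_creations, smul_eq_mul, creations]
    ring
  have h2 : ((Real.sqrt p.factorial : ℝ) : ℂ) * ((Real.sqrt p.factorial : ℝ) : ℂ) =
      p.factorial := by
    rw [← Complex.ofReal_mul, Real.mul_self_sqrt (by positivity), Complex.ofReal_natCast]
  rw [h1, Finset.sum_congr rfl fun J _ => by rw [sum_wedge_mul (antisymm_word_right ν J)],
    ← h2, mul_inv, mul_assoc, ← sum_wedge_mul (antisymm_word_left ν y) x, Finset.mul_sum]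
  refine Finset.sum_congr rfl fun J _ => by ring

lemma antisymmetrizer_mul_mul_apply (M : TensorOp d p) (x y : Fin p → Fin d) :
    (antisymmetrizer d p * M * antisymmetrizer d p) x y =
      (p.factorial : ℂ)⁻¹ * (p.factorial : ℂ)⁻¹ * ∑ π : Equiv.Perm (Fin p),
        ∑ κ : Equiv.Perm (Fin p), sgn π * sgn κ * M (x ∘ π) (y ∘ κ) := by
  have hA : ∀ z w, antisymmetrizer d p z w = (p.factorial : ℂ)⁻¹ *
      ∑ π : Equiv.Perm (Fin p), if z = w ∘ π then sgn π else 0 := by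
    intro z w
    rw [antisymmetrizer, Matrix.smul_apply, Matrix.sum_apply, smul_eq_mul]
    simp
  have hleft : ∀ w, (antisymmetrizer d p * M) x w = (p.factorial : ℂ)⁻¹ *
      ∑ π : Equiv.Perm (Fin p), sgn π * M (x ∘ π) w := by
    intro w
    have hinv : ∑ π : Equiv.Perm (Fin p), sgn π * M (x ∘ π) w =
        ∑ π : Equiv.Perm (Fin p), sgn π * M (x ∘ ⇑π⁻¹) w := by
      rw [← Equiv.sum_comp (Equiv.inv (Equiv.Perm (Fin p)))]
      simp only [Equiv.inv_apply, sgn_inv]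
    rw [Matrix.mul_apply, hinv]
    simp only [hA, mul_assoc, Finset.sum_mul, ← Finset.mul_sum]
    rw [Finset.sum_comm]
    congr 1
    refine Finset.sum_congr rfl fun π _ => ?_
    rw [Finset.sum_eq_single (x ∘ ⇑π⁻¹)]
    · rw [if_pos (by funext i; simp)]
    · intro z _ hz
      rw [if_neg, zero_mul]
      rintro rfl
      exact hz (by funext i; simp)
    · simp
  rw [Matrix.mul_apply]
  simp only [hleft, hA]
  have hright : ∀ N : (Fin p → Fin d) → ℂ,
      ∑ z, N z * ∑ κ : Equiv.Perm (Fin p), (if z = y ∘ κ then sgn κ else 0) =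
        ∑ κ : Equiv.Perm (Fin p), sgn κ * N (y ∘ κ) := by
    intro N
    simp only [Finset.mul_sum]
    rw [Finset.sum_comm]
    refine Finset.sum_congr rfl fun κ _ => ?_
    simp [mul_comm]
  calc _ = (p.factorial : ℂ)⁻¹ * (p.factorial : ℂ)⁻¹ *
        ∑ z, (∑ π : Equiv.Perm (Fin p), sgn π * M (x ∘ π) z) *
          ∑ κ : Equiv.Perm (Fin p), (if z = y ∘ κ then sgn κ else 0) := by
        rw [Finset.mul_sum]
        refine Finset.sum_congr rfl fun z _ => by ring
    _ = _ := by
        rw [hright, Finset.sum_comm]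
        congr 1
        refine Finset.sum_congr rfl fun κ _ => ?_
        rw [Finset.mul_sum]
        refine Finset.sum_congr rfl fun π _ => by ring

lemma antisymm_mul_antisymmetrizer_right (M : TensorOp d p) (x : Fin p → Fin d) :
    Antisymm fun y => (antisymmetrizer d p * M * antisymmetrizer d p) x y := by
  intro ρ y
  have h : ∀ π : Equiv.Perm (Fin p),
      ∑ κ : Equiv.Perm (Fin p), sgn π * sgn κ * M (x ∘ π) ((y ∘ ρ) ∘ κ) =
        sgn ρ * ∑ κ : Equiv.Perm (Fin p), sgn π * sgn κ * M (x ∘ π) (y ∘ κ) := by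
    intro π
    rw [← Equiv.sum_comp (Equiv.mulLeft ρ) fun κ => sgn π * sgn κ * M (x ∘ π) (y ∘ κ),
      Finset.mul_sum]
    refine Finset.sum_congr rfl fun κ _ => ?_
    rw [Equiv.coe_mulLeft, sgn_mul, Equiv.Perm.coe_mul, Function.comp_assoc]
    linear_combination (-(sgn π * sgn κ * M (x ∘ π) (y ∘ ρ ∘ κ))) * sgn_mul_self ρ
  simp only [antisymmetrizer_mul_mul_apply, h, ← Finset.mul_sum]
  ring

lemma antisymm_mul_antisymmetrizer_left (M : TensorOp d p) (y : Fin p → Fin d) :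
    Antisymm fun x => (antisymmetrizer d p * M * antisymmetrizer d p) x y := by
  intro ρ x
  have h : ∑ π : Equiv.Perm (Fin p), ∑ κ : Equiv.Perm (Fin p),
      sgn π * sgn κ * M ((x ∘ ρ) ∘ π) (y ∘ κ) =
        sgn ρ * ∑ π : Equiv.Perm (Fin p), ∑ κ : Equiv.Perm (Fin p),
          sgn π * sgn κ * M (x ∘ π) (y ∘ κ) := by
    rw [← Equiv.sum_comp (Equiv.mulLeft ρ) fun π => ∑ κ : Equiv.Perm (Fin p),
      sgn π * sgn κ * M (x ∘ π) (y ∘ κ), Finset.mul_sum]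
    refine Finset.sum_congr rfl fun π _ => ?_
    rw [Finset.mul_sum]
    refine Finset.sum_congr rfl fun κ _ => ?_
    rw [Equiv.coe_mulLeft, sgn_mul, Equiv.Perm.coe_mul, Function.comp_assoc]
    linear_combination (-(sgn π * sgn κ * M (x ∘ ρ ∘ π) (y ∘ κ))) * sgn_mul_self ρ
  simp only [antisymmetrizer_mul_mul_apply, h]
  ring

/-! ## Counting permutations -/

/-- The image under `π` of the first `k` elements. -/
def initialImage (k : ℕ) (π : Equiv.Perm (Fin p)) : Finset (Fin p) :=
  (Finset.univ.filter fun i : Fin p => i.val < k).image π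

lemma card_filter_lt {k : ℕ} (hk : k ≤ p) :
    (Finset.univ.filter fun i : Fin p => i.val < k).card = k := by
  have := Fintype.card_congr (Fin.castLEquiv hk)
  rw [Fintype.card_fin, Fintype.card_subtype] at this
  exact this.symm

lemma card_initialImage {k : ℕ} (hk : k ≤ p) (π : Equiv.Perm (Fin p)) :
    (initialImage k π).card = k := by
  rw [initialImage, Finset.card_image_of_injective _ π.injective, card_filter_lt hk]

lemma card_initialImage_eq {k : ℕ} {T : Finset (Fin p)} (hT : T.card = k) :
    (Finset.univ.filter fun π : Equiv.Perm (Fin p) => initialImage k π = T).card =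
      k.factorial * (p - k).factorial := by
  have h := Numbering.card_prefixed T
  rw [Fintype.card_fin, hT] at h
  rw [← h]
  let e : Equiv.Perm (Fin p) ≃ Numbering (Fin p) :=
    (Equiv.inv _).trans ((Equiv.refl _).equivCongr (finCongr (Fintype.card_fin p).symm))
  have he : ∀ π x, (e π x : ℕ) = π⁻¹ x := fun π x => rfl
  refine Finset.card_equiv e fun π => ?_
  simp only [Finset.mem_filter, Finset.mem_univ, true_and, Numbering.mem_prefixed,
    Numbering.IsPrefix, he, hT]
  rw [Finset.ext_iff]
  refine forall_congr' fun i => ?_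
  have : i ∈ initialImage k π ↔ (π⁻¹ i : ℕ) < k := by
    simp only [initialImage, Finset.mem_image, Finset.mem_filter, Finset.mem_univ, true_and]
    constructor
    · rintro ⟨j, hj, rfl⟩
      simpa using hj
    · intro h
      exact ⟨π⁻¹ i, h, by simp⟩
  rw [this]
  exact Iff.comm

lemma sum_initialImage {k : ℕ} (hk : k ≤ p) (h : Finset (Fin p) → ℂ) :
    ∑ π : Equiv.Perm (Fin p), h (initialImage k π) =
      (k.factorial * (p - k).factorial : ℂ) * ∑ T ∈ Finset.univ.powersetCard k, h T := by
  rw [← Finset.sum_fiberwise_of_maps_to (t := Finset.univ.powersetCard k)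
    (g := initialImage k) (fun π _ => by simp [Finset.mem_powersetCard, card_initialImage hk]),
    Finset.mul_sum]
  refine Finset.sum_congr rfl fun T hT => ?_
  rw [Finset.mem_powersetCard_univ] at hT
  rw [Finset.sum_congr rfl fun π hπ => by rw [(Finset.mem_filter.1 hπ).2], Finset.sum_const,
    card_initialImage_eq hT, nsmul_eq_mul]
  push_cast
  rfl

lemma sum_perm_of_fixes {k : ℕ} (hk : k ≤ p) (F : Equiv.Perm (Fin p) → ℂ)
    (hF : ∀ κ, F κ ≠ 0 → ∀ i : Fin p, k ≤ i.val → κ i = i) :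
    ∑ κ, F κ = ∑ κ : Equiv.Perm (Fin k), F (κ.extendDomain (Fin.castLEquiv hk)) := by
  refine (Finset.sum_of_injOn (fun κ : Equiv.Perm (Fin k) =>
    κ.extendDomain (Fin.castLEquiv hk)) ?_ (by simp) ?_ fun _ _ => rfl).symm
  · exact (Equiv.Perm.extendDomainHom_injective (Fin.castLEquiv hk)).injOn
  · intro κ _ hκ
    by_contra hne
    have hfix := hF κ hne
    have hlt : ∀ i : Fin p, i.val < k ↔ (κ i).val < k := by
      intro i
      constructor
      · intro hi
        by_contra hc
        have h1 := hfix (κ i) (not_lt.1 hc)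
        rw [κ.injective h1] at hc
        exact hc hi
      · intro hi
        by_contra hc
        rw [hfix i (not_lt.1 hc)] at hi
        exact hc hi
    refine hκ ⟨(Fin.castLEquiv hk).permCongr.symm (κ.subtypePerm fun i => (hlt i).symm), by simp, ?_⟩
    ext i
    by_cases hi : i.val < k
    · simp only [Equiv.Perm.extendDomain_apply_subtype _ (Fin.castLEquiv hk) hi]
      simp
    · simp only [Equiv.Perm.extendDomain_apply_not_subtype _ (Fin.castLEquiv hk) hi]
      rw [hfix i (not_lt.1 hi)]

end CreationProducts

section Expansion
variable {d p : ℕ} (ν : (Fock (Fin d) →L[ℂ] Fock (Fin d)) →ₗ[ℂ] ℂ)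

lemma apply_word_comp_right (x y : Fin p → Fin d) (π : Equiv.Perm (Fin p)) :
    ν (word x (y ∘ π) (List.finRange p)) = sgn π * ν (word x y (List.finRange p)) :=
  antisymm_word_right ν x π y

lemma apply_word_comp_left (x y : Fin p → Fin d) (π : Equiv.Perm (Fin p)) :
    ν (word (x ∘ π) y (List.finRange p)) = sgn π * ν (word x y (List.finRange p)) :=
  antisymm_word_left ν y π x

lemma tensorPad_scalar_apply {k : ℕ} (hk : k ≤ p) (M : TensorOp d k) (σ : ℂ)
    (x y : Fin p → Fin d) :
    tensorPad hk M (σ • (1 : Matrix (Fin d) (Fin d) ℂ)) x y =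
      M (x ∘ Fin.castLE hk) (y ∘ Fin.castLE hk) *
        ∏ i : Fin p with k ≤ i.1, if x i = y i then σ else 0 := by
  simp only [tensorPad, Matrix.of_apply, Matrix.smul_apply, Matrix.one_apply, smul_eq_mul, mul_ite,
    mul_one, mul_zero]
  rfl

lemma word_comp_castLE {k : ℕ} (hk : k ≤ p) (x y : Fin p → Fin d) (π : Equiv.Perm (Fin p)) :
    word ((x ∘ π) ∘ Fin.castLE hk) ((y ∘ π) ∘ Fin.castLE hk) (List.finRange k) =
      finWord x y (initialImage k π) := by
  have hinj : Function.Injective (π ∘ Fin.castLE hk) :=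
    π.injective.comp (Fin.castLE_injective hk)
  rw [Function.comp_assoc, Function.comp_assoc, ← word_map, finWord]
  refine word_perm x y ((List.perm_ext_iff_of_nodup ((List.nodup_finRange k).map hinj)
    (Finset.nodup_toList _)).2 fun i => ?_)
  simp only [List.mem_map, List.mem_finRange, true_and, Function.comp_apply, Finset.mem_toList,
    initialImage, Finset.mem_image, Finset.mem_filter, Finset.mem_univ]
  constructor
  · rintro ⟨j, rfl⟩
    exact ⟨Fin.castLE hk j, j.isLt, rfl⟩
  · rintro ⟨j, hj, rfl⟩
    exact ⟨⟨j, hj⟩, rfl⟩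

lemma prod_filter_le_perm {k : ℕ} (w : Fin p → ℂ) (π : Equiv.Perm (Fin p)) :
    ∏ i : Fin p with k ≤ i.1, w (π i) = ∏ i ∈ Finset.univ \ initialImage k π, w i := by
  rw [← Finset.prod_image (s := Finset.univ.filter fun i : Fin p => k ≤ i.1) (g := π)
    π.injective.injOn]
  refine Finset.prod_congr ?_ fun _ _ => rfl
  ext i
  simp only [initialImage, Finset.mem_image, Finset.mem_filter, Finset.mem_univ, true_and,
    Finset.mem_sdiff, not_exists, not_and]
  constructor
  · rintro ⟨j, hj, rfl⟩ l hl hlj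
    rw [π.injective hlj] at hl
    omega
  · intro h
    refine ⟨π⁻¹ i, ?_, by simp⟩
    by_contra hc
    exact h (π⁻¹ i) (not_le.1 hc) (by simp)

lemma sum_sgn_mul_tensorPad {x y : Fin p → Fin d} (h : Aligned x y) (σ : ℂ) {k : ℕ} (hk : k ≤ p)
    (π : Equiv.Perm (Fin p)) :
    ∑ κ : Equiv.Perm (Fin p), sgn π * sgn κ *
        tensorPad hk (reducedDensity ν k) (σ • (1 : Matrix (Fin d) (Fin d) ℂ)) (x ∘ π) (y ∘ κ) =
      ν (finWord x y (initialImage k π)) *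
        ∏ i ∈ Finset.univ \ initialImage k π, if x i = y i then σ else 0 := by
  have hk0 : (k.factorial : ℂ) ≠ 0 := by exact_mod_cast k.factorial_ne_zero
  rw [← Equiv.sum_comp (Equiv.mulLeft π), sum_perm_of_fixes hk]
  · have hterm : ∀ κ : Equiv.Perm (Fin k),
        sgn π * sgn (Equiv.mulLeft π (κ.extendDomain (Fin.castLEquiv hk))) *
          tensorPad hk (reducedDensity ν k) (σ • (1 : Matrix (Fin d) (Fin d) ℂ)) (x ∘ π)
            (y ∘ Equiv.mulLeft π (κ.extendDomain (Fin.castLEquiv hk))) =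
        (k.factorial : ℂ)⁻¹ * (ν (finWord x y (initialImage k π)) *
          ∏ i ∈ Finset.univ \ initialImage k π, if x i = y i then σ else 0) := by
      intro κ
      have hs : sgn (κ.extendDomain (Fin.castLEquiv hk)) = sgn κ := by
        rw [sgn, Equiv.Perm.sign_extendDomain, sgn]
      have hy : (y ∘ (π * κ.extendDomain (Fin.castLEquiv hk))) ∘ Fin.castLE hk =
          ((y ∘ π) ∘ Fin.castLE hk) ∘ κ := by
        funext i
        have := Equiv.Perm.extendDomain_apply_image κ (Fin.castLEquiv hk) i
        exact congrArg (fun j => y (π j)) this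
      have hprod : (∏ i : Fin p with k ≤ i.1,
          if (x ∘ π) i = (y ∘ (π * κ.extendDomain (Fin.castLEquiv hk))) i then σ else 0) =
          ∏ i ∈ Finset.univ \ initialImage k π, if x i = y i then σ else 0 := by
        rw [← prod_filter_le_perm]
        refine Finset.prod_congr rfl fun i hi => ?_
        have hi' : ¬ i.val < k := not_lt.2 (Finset.mem_filter.1 hi).2
        have := Equiv.Perm.extendDomain_apply_not_subtype κ (Fin.castLEquiv hk) hi'
        simp only [Function.comp_apply, Equiv.Perm.coe_mul, this]
      rw [Equiv.coe_mulLeft]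
      beta_reduce
      rw [tensorPad_scalar_apply, hprod, hy, reducedDensity_apply,
        apply_word_comp_right, word_comp_castLE, sgn_mul, hs]
      linear_combination (sgn κ * sgn κ * ((k.factorial : ℂ)⁻¹ *
        (ν (finWord x y (initialImage k π)) *
          ∏ i ∈ Finset.univ \ initialImage k π, if x i = y i then σ else 0))) * sgn_mul_self π +
        ((k.factorial : ℂ)⁻¹ * (ν (finWord x y (initialImage k π)) *
          ∏ i ∈ Finset.univ \ initialImage k π, if x i = y i then σ else 0)) * sgn_mul_self κ
    rw [Finset.sum_congr rfl fun κ _ => hterm κ, Finset.sum_const, Finset.card_univ,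
      Fintype.card_perm, Fintype.card_fin, nsmul_eq_mul, mul_inv_cancel_left₀ hk0]
  · intro κ hκ i hi
    by_contra hne
    refine hκ ?_
    rw [tensorPad_scalar_apply, Finset.prod_eq_zero (i := i) (by simpa using hi), mul_zero,
      mul_zero]
    refine if_neg fun hxy => hne ?_
    exact π.injective (h.eq_of_eq _ _ hxy).symm

lemma antisymmetrize_tensorPad_apply {x y : Fin p → Fin d} (h : Aligned x y) (σ : ℂ) {k : ℕ}
    (hk : k ≤ p) :
    (p.choose k : ℂ) * (antisymmetrizer d p *
        tensorPad hk (reducedDensity ν k) (σ • (1 : Matrix (Fin d) (Fin d) ℂ)) *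
          antisymmetrizer d p) x y =
      (p.factorial : ℂ)⁻¹ * ∑ T ∈ Finset.univ.powersetCard k, ν (finWord x y T) *
        ∏ i ∈ Finset.univ \ T, if x i = y i then σ else 0 := by
  have hp0 : (p.factorial : ℂ) ≠ 0 := by exact_mod_cast p.factorial_ne_zero
  have hc : (p.choose k : ℂ) * (k.factorial * (p - k).factorial) = p.factorial := by
    rw [← mul_assoc]
    exact_mod_cast Nat.choose_mul_factorial_mul_factorial hk
  rw [antisymmetrizer_mul_mul_apply,
    Finset.sum_congr rfl fun π _ => sum_sgn_mul_tensorPad ν h σ hk π,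
    sum_initialImage hk fun T => ν (finWord x y T) *
      ∏ i ∈ Finset.univ \ T, if x i = y i then σ else 0]
  set S := ∑ T ∈ Finset.univ.powersetCard k, ν (finWord x y T) *
        ∏ i ∈ Finset.univ \ T, if x i = y i then σ else 0
  calc _ = (p.factorial : ℂ)⁻¹ * ((p.factorial : ℂ)⁻¹ *
        ((p.choose k : ℂ) * (k.factorial * (p - k).factorial))) * S := by ring
    _ = _ := by rw [hc, inv_mul_cancel₀ hp0, mul_one]

lemma apply_mix {x y : Fin p → Fin d} (μ σ : ℂ) :
    ν (mix (fun _ => μ) (fun i => (1 - μ) * if x i = y i then σ else 0) (finWord x y)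
      Finset.univ) = ∑ k ∈ Finset.range (p + 1), μ ^ k * (1 - μ) ^ (p - k) *
        ∑ T ∈ Finset.univ.powersetCard k, ν (finWord x y T) *
          ∏ i ∈ Finset.univ \ T, if x i = y i then σ else 0 := by
  rw [map_mix, mix, Finset.sum_powerset, Finset.card_univ, Fintype.card_fin]
  refine Finset.sum_congr rfl fun k _ => ?_
  rw [Finset.mul_sum]
  refine Finset.sum_congr rfl fun T hT => ?_
  have hT := Finset.mem_powersetCard_univ.1 hT
  rw [Finset.prod_mul_distrib, Finset.prod_const, Finset.prod_const,
    Finset.card_univ_sdiff, Fintype.card_fin, hT, smul_eq_mul]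
  ring

lemma matrix_eq_of_aligned {A B : TensorOp d p} (hA₁ : ∀ y, Antisymm fun x => A x y)
    (hA₂ : ∀ x, Antisymm (A x)) (hB₁ : ∀ y, Antisymm fun x => B x y) (hB₂ : ∀ x, Antisymm (B x))
    (h : ∀ x y, Aligned x y → A x y = B x y) : A = B := by
  ext x y
  by_cases hx : Function.Injective x
  · by_cases hy : Function.Injective y
    · obtain ⟨π, hπ⟩ := exists_perm_aligned hx hy
      rw [(hA₂ x).perm_eq π, (hB₂ x).perm_eq π, h _ _ hπ]
    · rw [(hA₂ x).eq_zero hy, (hB₂ x).eq_zero hy]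
  · rw [(hA₁ y).eq_zero hx, (hB₁ y).eq_zero hx]

lemma antisymm_sum {ι κ : Type} {s : Finset κ} {F : κ → (Fin p → ι) → ℂ} (c : κ → ℂ)
    (h : ∀ k, Antisymm (F k)) : Antisymm fun x => ∑ k ∈ s, c k * F k x := by
  intro π x
  rw [Finset.mul_sum]
  refine Finset.sum_congr rfl fun k _ => ?_
  rw [h k]
  ring

end Expansion
end FermiWalk

end

open FermiWalk in
theorem mainTheorem10 (d : ℕ) [NeZero d] (α σ : ℝ) (hσ0 : 0 ≤ σ) (hσ1 : σ ≤ 1)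
    (ω : (Fock ℤ →L[ℂ] Fock ℤ) →ₗ[ℂ] ℂ) (hω : IsState ω)
    (hqf : IsQuasiFree ((σ : ℂ) • (1 : ReservoirSpace →L[ℂ] ReservoirSpace)) ω)
    (ρ : Fock (Fin d) →L[ℂ] Fock (Fin d)) (hρ : IsDensityMatrix ρ)
    (m p : ℕ) (hp : p ≤ d) :
    reducedDensity (sampleState α ω ρ (m * d)) p =
      ∑ k : Fin (p + 1),
        ((p.choose k : ℂ) * (1 - (Real.cos α : ℂ) ^ (2 * m)) ^ (p - k.1) *
            (Real.cos α : ℂ) ^ (2 * m * k.1)) •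
          (antisymmetrizer d p *
            tensorPad k.is_le (reducedDensity (expectation ρ) k)
              ((σ : ℂ) • (1 : Matrix (Fin d) (Fin d) ℂ)) *
            antisymmetrizer d p) := by
  set c : ℂ := ((Real.cos α : ℝ) : ℂ) with hc
  let Φ := channel (d := d) σ c (1 - c ^ 2)
  let ν : (Fock (Fin d) →L[ℂ] Fock (Fin d)) →ₗ[ℂ] ℂ := expectationₗ ρ ∘ₗ Φ ^ (m * d)
  have hq : ((Real.sin α : ℝ) : ℂ) ^ 2 = 1 - c ^ 2 := by
    rw [hc, ← Complex.ofReal_pow, ← Complex.ofReal_pow, Real.sin_sq]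
    push_cast
    rfl
  have hν : sampleState α ω ρ (m * d) = ν := by
    rw [sampleState_eq hqf hω.2]
    funext A
    rw [hq]
    exact congrArg _ (Module.End.pow_apply Φ (m * d) A).symm
  have hρ' : expectation ρ = expectationₗ ρ := rfl
  rw [hν, hρ']
  have hcoe : ∀ x y, (∑ k : Fin (p + 1),
        ((p.choose k : ℂ) * (1 - c ^ (2 * m)) ^ (p - k.1) * c ^ (2 * m * k.1)) •
          (antisymmetrizer d p * tensorPad k.is_le (reducedDensity (expectationₗ ρ) k)
              ((σ : ℂ) • (1 : Matrix (Fin d) (Fin d) ℂ)) * antisymmetrizer d p)) x y =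
      ∑ k : Fin (p + 1),
        ((p.choose k : ℂ) * (1 - c ^ (2 * m)) ^ (p - k.1) * c ^ (2 * m * k.1)) *
          (antisymmetrizer d p * tensorPad k.is_le (reducedDensity (expectationₗ ρ) k)
              ((σ : ℂ) • (1 : Matrix (Fin d) (Fin d) ℂ)) * antisymmetrizer d p) x y := by
    intro x y
    rw [Matrix.sum_apply]
    rfl
  refine matrix_eq_of_aligned (fun y => ?_) (fun x => ?_) (fun y => ?_) (fun x => ?_) ?_
  · intro π x
    beta_reduce
    rw [reducedDensity_apply, reducedDensity_apply, apply_word_comp_left]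
    ring
  · intro π y
    rw [reducedDensity_apply, reducedDensity_apply, apply_word_comp_right]
    ring
  · simp only [hcoe]
    exact antisymm_sum _ fun k => antisymm_mul_antisymmetrizer_left _ y
  · intro π y
    simp only [hcoe]
    exact antisymm_sum _ (fun k => antisymm_mul_antisymmetrizer_right _ x) π y
  · intro x y hxy
    have huniv : word x y (List.finRange p) = finWord x y Finset.univ :=
      word_perm x y ((List.perm_ext_iff_of_nodup (List.nodup_finRange p)
        (Finset.nodup_toList _)).2 fun i => by simp)
    have hword : ν (word x y (List.finRange p)) = expectationₗ ρ
        (mix (fun _ => c ^ (2 * m)) (fun i => (1 - c ^ (2 * m)) * if x i = y i then (σ : ℂ) else 0)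
          (finWord x y) Finset.univ) := by
      rw [← channel_iterate_period (σ : ℂ) c hxy m Finset.univ, huniv]
      exact congrArg (expectationₗ ρ) (Module.End.pow_apply Φ (m * d) _)
    rw [hcoe, reducedDensity_apply, hword, apply_mix, Finset.sum_range, Finset.mul_sum]
    refine Finset.sum_congr rfl fun k _ => ?_
    rw [mul_left_comm, ← antisymmetrize_tensorPad_apply (expectationₗ ρ) hxy (σ : ℂ) k.is_le,
      pow_mul c (2 * m) k]
    ring
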